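/- Fix $m\ge 1$. Outcomes are $0,1,\dots,m$, where $0$ is the null outcome and $1,\dots,m$ are the non-null outcomes, and the principal's value vector is $v=(0,1,\dots,1)\in[0,1]^{m+1}$. A (single-type) instance $I$ consists of a finite action set $\mathcal A$, a production function $p(\cdot\mid a)$, $a\in\mathcal A$, with values in the probability distributions on the outcomes, and a cost function $c:\mathcal A\to[0,1]$, such that $\mathcal A$ contains a null action of cost $0$ that leads to outcome $0$ with probability one. A contract is a vector $f\in[0,1]^{m+1}$; in response to $f$ the agent plays $$a^\star(f)\in\arg\max_{a\in\mathcal A}\ \sum_{o=0}^m p(o\mid a)f_o-c(a),$$ ties being broken in favour of the principal (in any measurable way if this leaves several actions), and the principal's utility is $u_I(f)=\sum_{o=0}^m p(o\mid a^\star(f))(v_o-f_o)$. In each round $t=1,\dots,T$ a policy $\pi$ draws a contract $f^{(t)}\in[0,1]^{m+1}$ from a distribution that depends measurably on the history $(f^{(1)},o^{(1)},\dots,f^{(t-1)},o^{(t-1)})$, and then observes an outcome $o^{(t)}\sim p(\cdot\mid a^\star(f^{(t)}))$. **Theorem.** There is a universal constant $C>0$ such that for all $m\ge1$, all integers $T>2^{m+2}$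 and every policy $\pi$ there is an instance $I$ with $m$ non-null outcomes, for which $u_I$ attains its maximum over $[0,1]^{m+1}$ at some contract $f^\star$ and $$\sum_{t=1}^T\mathbb E\big[u_I(f^\star)-u_I(f^{(t)})\big]\ \ge\ C\,T^{1-1/(m+2)}.$$ -/

import Mathlib

open MeasureTheory ProbabilityTheory
open scoped BigOperators

noncomputable section

namespace OnlineContract

/-- Outcomes: `0` is the null outcome, the remaining `m` outcomes are the non-null ones. -/
abbrev Outcome (m : ℕ) : Type := Fin (m + 1)

/-- The contract space `[0,1]^(m+1)`: a contract pays `f o ∈ [0,1]` when the outcome is `o`. -/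
abbrev Contract (m : ℕ) : Type := Outcome m → unitInterval

/-- The principal's value vector `v = (0, 1, …, 1)`. -/
def value (m : ℕ) (o : Outcome m) : ℝ := if o = 0 then 0 else 1

/-- A single-type problem instance with `m` non-null outcomes and a finite action set: a production
function `p(· | a)`, a cost function `c : 𝒜 → [0,1]`, and a null action of cost `0` that leads to
the null outcome surely. (The value vector is always `value m`.) -/
structure ContractInstance (m : ℕ) where
  Action : Type
  [fintypeAction : Fintype Action]
  /-- `prod a` is the distribution `p(· | a)` of the outcome under the action `a`. -/
  prod : Action → PMF (Outcome m)
  cost : Action → ℝ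
  cost_nonneg : ∀ a, 0 ≤ cost a
  cost_le_one : ∀ a, cost a ≤ 1
  nullAction : Action
  cost_null : cost nullAction = 0
  prod_null : prod nullAction = PMF.pure 0

attribute [instance] ContractInstance.fintypeAction

namespace ContractInstance

variable {m : ℕ} (I : ContractInstance m)

/-- The agent's expected utility `∑ₒ p(o | a) f(o) - c(a)` from action `a` under contract `f`. -/
def agentUtility (f : Contract m) (a : I.Action) : ℝ :=
  ∑ o, (I.prod a o).toReal * (f o : ℝ) - I.cost a

/-- The principal's expected utility `∑ₒ p(o | a) (v(o) - f(o))` if the agent takes action `a`. -/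
def principalUtility (f : Contract m) (a : I.Action) : ℝ :=
  ∑ o, (I.prod a o).toReal * (value m o - (f o : ℝ))

/-- `a` maximizes the agent's utility under `f`. -/
def IsAgentOptimal (f : Contract m) (a : I.Action) : Prop :=
  ∀ b, I.agentUtility f b ≤ I.agentUtility f a

/-- `a` is a best response of the agent to `f`, ties being broken in favour of the principal. -/
def IsBestResponse (f : Contract m) (a : I.Action) : Prop :=
  I.IsAgentOptimal f a ∧
    ∀ b, I.IsAgentOptimal f b → I.principalUtility f b ≤ I.principalUtility f a

/-- A (measurable) choice `f ↦ a⋆(f)` of best responses. -/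
structure BestResponse where
  act : Contract m → I.Action
  measurableSet_act : ∀ a, MeasurableSet {f | act f = a}
  isBestResponse : ∀ f, I.IsBestResponse f (act f)

lemma exists_isBestResponse (f : Contract m) : ∃ a, I.IsBestResponse f a := by
  classical
  have : Nonempty I.Action := ⟨I.nullAction⟩
  obtain ⟨a₀, h₀⟩ := Finite.exists_max (I.agentUtility f)
  obtain ⟨a, ha, hmax⟩ := (Finset.univ.filter (I.IsAgentOptimal f)).exists_max_image
    (I.principalUtility f) ⟨a₀, by simpa [IsAgentOptimal] using h₀⟩
  exact ⟨a, by simpa using ha, fun b hb => hmax b (by simpa using hb)⟩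

lemma measurable_agentUtility (a : I.Action) : Measurable fun f => I.agentUtility f a := by
  unfold agentUtility
  fun_prop

lemma measurable_principalUtility (a : I.Action) :
    Measurable fun f => I.principalUtility f a := by
  unfold principalUtility
  fun_prop

lemma measurableSet_isAgentOptimal (a : I.Action) : MeasurableSet {f | I.IsAgentOptimal f a} := by
  have : {f | I.IsAgentOptimal f a} =
      ⋂ b, {f | I.agentUtility f b ≤ I.agentUtility f a} := by
    ext f; simp [IsAgentOptimal]
  rw [this]
  exact MeasurableSet.iInter fun b =>
    measurableSet_le (I.measurable_agentUtility b) (I.measurable_agentUtility a)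

lemma measurableSet_isBestResponse (a : I.Action) : MeasurableSet {f | I.IsBestResponse f a} := by
  have : {f | I.IsBestResponse f a} = {f | I.IsAgentOptimal f a} ∩
      ⋂ b, ({f | I.IsAgentOptimal f b}ᶜ ∪
        {f | I.principalUtility f b ≤ I.principalUtility f a}) := by
    ext f; simp [IsBestResponse, imp_iff_not_or]
  rw [this]
  exact (I.measurableSet_isAgentOptimal a).inter (MeasurableSet.iInter fun b =>
    (I.measurableSet_isAgentOptimal b).compl.union
      (measurableSet_le (I.measurable_principalUtility b) (I.measurable_principalUtility a)))

/-- Measurable best responses exist for every instance. -/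
instance : Nonempty I.BestResponse := by
  classical
  let e := Fintype.equivFin I.Action
  have hex : ∀ f : Contract m, (Finset.univ.filter
      (fun i => I.IsBestResponse f (e.symm i))).Nonempty := fun f => by
    obtain ⟨a, ha⟩ := I.exists_isBestResponse f
    exact ⟨e a, by simpa using ha⟩
  have hmem : ∀ f, I.IsBestResponse f (e.symm (Finset.min' _ (hex f))) := fun f => by
    simpa using Finset.min'_mem _ (hex f)
  refine ⟨⟨fun f => e.symm (Finset.min' _ (hex f)), fun a => ?_, hmem⟩⟩
  have : {f | e.symm (Finset.min' _ (hex f)) = a} = {f | I.IsBestResponse f a} ∩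
      ⋂ b, {f | ¬ (e b < e a ∧ I.IsBestResponse f b)} := by
    ext f
    simp only [Set.mem_ofPred_eq, Set.mem_inter_iff, Set.mem_iInter]
    constructor
    · intro h
      refine ⟨h ▸ hmem f, fun b hb => ?_⟩
      have h1 : Finset.min' _ (hex f) ≤ e b := Finset.min'_le _ _ (by simpa using hb.2)
      have h2 : Finset.min' _ (hex f) = e a := by rw [← h]; simp
      exact absurd hb.1 (not_lt.2 (h2 ▸ h1))
    · rintro ⟨h1, h2⟩
      rw [Equiv.symm_apply_eq]
      refine le_antisymm (Finset.min'_le _ _ (by simpa using h1)) (not_lt.1 fun h => ?_)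
      exact h2 _ ⟨by simpa using h, hmem f⟩
  rw [this]
  refine (I.measurableSet_isBestResponse a).inter (MeasurableSet.iInter fun b => ?_)
  by_cases h : e b < e a
  · have hb : {f | ¬ (e b < e a ∧ I.IsBestResponse f b)} = {f | I.IsBestResponse f b}ᶜ := by
      ext f; simp [h]
    rw [hb]
    exact (I.measurableSet_isBestResponse b).compl
  · simp [h]

namespace BestResponse

variable {I} (br : I.BestResponse)

/-- The principal's utility `u(f) = ∑ₒ p(o | a⋆(f)) (v(o) - f(o))` from posting contract `f`. -/
def utility (f : Contract m) : ℝ := I.principalUtility f (br.act f)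

/-- The law `p(· | a⋆(f))` of the observed outcome, given the posted contract `f`. -/
def outcomeKernel : Kernel (Contract m) (Outcome m) where
  toFun f := (I.prod (br.act f)).toMeasure
  measurable' := by
    refine Measure.measurable_of_measurable_coe _ fun s _ t _ => ?_
    have : (fun f => (I.prod (br.act f)).toMeasure s) ⁻¹' t =
        ⋃ a : {a : I.Action // (I.prod a).toMeasure s ∈ t}, {f | br.act f = a} := by
      ext f; simp
    rw [this]
    exact MeasurableSet.iUnion fun a => br.measurableSet_act a

instance : IsMarkovKernel br.outcomeKernel :=
  ⟨fun f => PMF.toMeasure.isProbabilityMeasure (I.prod (br.act f))⟩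

end BestResponse

end ContractInstance

/-- The history `(f⁽¹⁾, o⁽¹⁾, …, f⁽ᵗ⁾, o⁽ᵗ⁾)` of the first `t` rounds. -/
abbrev History (m t : ℕ) : Type := Fin t → Contract m × Outcome m

/-- A randomized, history-dependent policy: `query t` is the conditional law of the contract posted
in the round that follows `t` completed rounds, given the history of these rounds. -/
structure Policy (m : ℕ) where
  query : ∀ t : ℕ, Kernel (History m t) (Contract m)
  [isMarkov : ∀ t, IsMarkovKernel (query t)]

attribute [instance] Policy.isMarkov

variable {m : ℕ} {I : ContractInstance m}

/-- One round of interaction: given the history, the contract is drawn from the policy, and then the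
outcome is drawn from the law induced by the agent's best response to that contract. -/
def roundKernel (br : I.BestResponse) (π : Policy m) (t : ℕ) :
    Kernel (History m t) (Contract m × Outcome m) :=
  (π.query t) ⊗ₖ (br.outcomeKernel.prodMkLeft (History m t))

instance (br : I.BestResponse) (π : Policy m) (t : ℕ) : IsMarkovKernel (roundKernel br π t) := by
  unfold roundKernel
  infer_instance

/-- The law of the history of the first `t` rounds. -/
def historyLaw (br : I.BestResponse) (π : Policy m) : ∀ t : ℕ, Measure (History m t)
  | 0 => Measure.dirac Fin.elim0
  | t + 1 => ((historyLaw br π t) ⊗ₘ (roundKernel br π t)).map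
      fun x : History m t × (Contract m × Outcome m) =>
        (Fin.snoc x.1 x.2 : History m (t + 1))

lemma measurable_snoc (m t : ℕ) :
    Measurable fun x : History m t × (Contract m × Outcome m) =>
      (Fin.snoc x.1 x.2 : History m (t + 1)) := by
  refine measurable_pi_lambda _ fun i => ?_
  refine Fin.lastCases ?_ (fun j => ?_) i
  · simpa using measurable_snd
  · simp only [Fin.snoc_castSucc]
    exact (measurable_pi_apply j).comp measurable_fst

instance (br : I.BestResponse) (π : Policy m) (t : ℕ) :
    IsProbabilityMeasure (historyLaw br π t) := by
  induction t with
  | zero => unfold historyLaw; infer_instance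
  | succ t ih =>
    unfold historyLaw
    exact Measure.isProbabilityMeasure_map (measurable_snoc m t).aemeasurable

/-- The expected regret `∑_{t=1}^T 𝔼[u(g) - u(f⁽ᵗ⁾)]` of the policy `π` over `T` rounds, relative to
posting the fixed contract `g` in each round. -/
def expectedRegret (br : I.BestResponse) (π : Policy m) (T : ℕ) (g : Contract m) : ℝ :=
  ∑ t : Fin T, ∫ h, (br.utility g - br.utility (h t).1) ∂(historyLaw br π T)

end OnlineContract

end

namespace OnlineContract

/-! ### A discrete change of measure inequality -/

/-! The lower bound is a needle-in-a-haystack argument. The agent chooses one of `2 * n` effort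
levels in each of the `m` coordinates, and the breakpoints are placed so that the principal can
never earn more than `1 / 8`, while every level in the upper half earns exactly `1 / 8` at its
breakpoint (`slope_mul_breakpoint`). A rebate of `1 / (32 n²)` on the cost of one upper-half action
`k` lets the principal implement `k` with payments lower by `1 / (8 n)`, which raises the optimum to
at least `1 / 8 + 1 / (32 n)` (`exists_le_utility`). Outside the region where `k` is optimal for the
agent, nothing changes (`utility_le_of_notMem`), so each round spent there costs `1 / (32 n)`.

The breakpoints are `1 / (8 n)` apart, so a wrong level at distance `d` loses the agent an amount
quadratic in `d`. The small rebate can therefore make `k` optimal only near the contracts that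
already induce levels close to those of `k`. This has two consequences. A contract lies in at most
`12 ^ m` of the `n ^ m` possible regions (`sum_indicator_hiddenRegion_le`), and even inside the
region the outcome laws with and without rebate differ by at most `2 / n²` in chi-square divergence
(`sum_sq_div_outcomeWeight_le`).

By averaging, some region is visited at most `T (12 / n) ^ m` times in expectation when there is no
rebate. If `n` is of order `T ^ (1 / (m + 2))`, these visits reveal only a constant amount of
information, and the change of measure `integral_historyLaw_le` shows that with the rebate the
region is still missed in a quarter of the rounds on average. The regret is then at least of order
`T / n`. -/

lemma mul_le_sq_sub_add_exp {w : ℝ} (hw : 0 ≤ w) (g : ℝ) :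
    w * g ≤ w ^ 2 - 2 * w + Real.exp g := by
  rcases hw.eq_or_lt with rfl | hw
  · simpa using (Real.exp_pos g).le
  -- Fenchel's inequality `w g ≤ w log w - w + exp g`, in which `log w ≤ w - 1` then turns the
  -- entropy into a chi-square term.
  have h1 := Real.add_one_le_exp (g - Real.log w)
  rw [Real.exp_sub, Real.exp_log hw, le_div_iff₀ hw] at h1
  have h2 := Real.log_le_sub_one_of_pos hw
  nlinarith

/-- The Donsker–Varadhan inequality on a finite type, with the relative entropy bounded by the
chi-square divergence. -/
lemma sum_mul_le_log_sum_exp_add {ι : Type*} [Fintype ι] {p q : ι → ℝ} {κ : ℝ}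
    (hp : ∀ i, 0 ≤ p i) (hq : ∀ i, 0 ≤ q i) (hpq : ∀ i, q i = 0 → p i = 0)
    (hp1 : ∑ i, p i = 1) (hq1 : ∑ i, q i = 1) (hκ : ∑ i, p i ^ 2 / q i ≤ 1 + κ) (G : ι → ℝ) :
    ∑ i, p i * G i ≤ Real.log (∑ i, q i * Real.exp (G i)) + κ := by
  set Z := ∑ i, q i * Real.exp (G i) with hZ
  have hZpos : 0 < Z := by
    have hne : ∃ i ∈ Finset.univ, 0 < q i := by
      by_contra! h
      have := Finset.sum_nonpos h
      linarith
    obtain ⟨i, _, hi⟩ := hne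
    exact Finset.sum_pos' (fun j _ => mul_nonneg (hq j) (Real.exp_pos _).le)
      ⟨i, Finset.mem_univ i, mul_pos hi (Real.exp_pos _)⟩
  -- The pointwise bound with `w = p i / q i`. Shifting `G` by `log Z` normalizes the exponential
  -- moment to one, so the linear terms sum to `-2 + 1`.
  have key : ∀ i, p i * (G i - Real.log Z) ≤
      p i ^ 2 / q i - 2 * p i + q i * Real.exp (G i) / Z := by
    intro i
    rcases (hq i).eq_or_lt with h | h
    · simp [hpq i h.symm, ← h]
    have h1 := mul_le_sq_sub_add_exp (div_nonneg (hp i) h.le) (G i - Real.log Z)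
    rw [Real.exp_sub, Real.exp_log hZpos] at h1
    have h2 := mul_le_mul_of_nonneg_left h1 h.le
    calc p i * (G i - Real.log Z) = q i * (p i / q i * (G i - Real.log Z)) := by field_simp
      _ ≤ _ := h2
      _ = _ := by field_simp
  have hsum := Finset.sum_le_sum fun i (_ : i ∈ Finset.univ) => key i
  simp only [mul_sub, Finset.sum_sub_distrib, Finset.sum_add_distrib, ← Finset.sum_mul,
    ← Finset.mul_sum, ← Finset.sum_div, hp1] at hsum
  rw [← hZ, div_self hZpos.ne'] at hsum
  linarith

/-! ### Integration over histories -/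

variable {m : ℕ}

lemma integrable_of_abs_le {α : Type*} [MeasurableSpace α] {μ : Measure α} [IsFiniteMeasure μ]
    {F : α → ℝ} (hF : Measurable F) (C : ℝ) (hb : ∀ x, |F x| ≤ C) : Integrable F μ :=
  .of_bound hF.aestronglyMeasurable C (.of_forall hb)

lemma sum_toReal_eq_one (p : PMF (Outcome m)) : ∑ o, (p o).toReal = 1 := by
  rw [← ENNReal.toReal_sum fun o _ => p.apply_ne_top o, ← tsum_fintype (L := .unconditional _),
    p.tsum_coe, ENNReal.toReal_one]

lemma integral_roundKernel {I : ContractInstance m} (br : I.BestResponse) (π : Policy m) (t : ℕ)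
    (h : History m t) {g : Contract m × Outcome m → ℝ} (hg : Measurable g) (C : ℝ)
    (hb : ∀ y, |g y| ≤ C) :
    ∫ y, g y ∂(roundKernel br π t h) =
      ∫ f, ∑ o, (I.prod (br.act f) o).toReal * g (f, o) ∂(π.query t h) := by
  unfold roundKernel
  rw [ProbabilityTheory.integral_compProd (integrable_of_abs_le hg C hb)]
  refine integral_congr_ae (.of_forall fun f => ?_)
  simp only [Kernel.prodMkLeft_apply]
  change ∫ o, g (f, o) ∂((I.prod (br.act f)).toMeasure) = _
  rw [PMF.integral_eq_sum]
  simp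

lemma integral_historyLaw_succ {I : ContractInstance m} (br : I.BestResponse) (π : Policy m)
    (t : ℕ) {F : History m (t + 1) → ℝ} (hF : Measurable F) (C : ℝ) (hb : ∀ h, |F h| ≤ C) :
    ∫ h, F h ∂(historyLaw br π (t + 1)) =
      ∫ h, ∫ y, F (Fin.snoc h y) ∂(roundKernel br π t h) ∂(historyLaw br π t) := by
  rw [historyLaw, integral_map (measurable_snoc m t).aemeasurable hF.aestronglyMeasurable,
    Measure.integral_compProd]
  exact integrable_of_abs_le (hF.comp (measurable_snoc m t)) C fun x => hb _

/-- One step of the change of measure, `p` and `q` being the laws of the outcomes under `br` and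
`br'`. -/
lemma integral_roundKernel_le {I I' : ContractInstance m} (br : I.BestResponse)
    (br' : I'.BestResponse) (π : Policy m) (t : ℕ) (h : History m t) {R : Set (Contract m)}
    (hR : MeasurableSet R) {κ : ℝ}
    (hdv : ∀ f (G : Outcome m → ℝ), ∑ o, (I.prod (br.act f) o).toReal * G o ≤
      Real.log (∑ o, (I'.prod (br'.act f) o).toReal * Real.exp (G o)) +
        κ * R.indicator 1 f)
    {g : Contract m × Outcome m → ℝ} (hg : Measurable g) (h0 : ∀ y, 0 ≤ g y) (h1 : ∀ y, g y ≤ 1) :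
    ∫ y, g y ∂(roundKernel br π t h) ≤
      Real.log (∫ y, Real.exp (g y) ∂(roundKernel br' π t h)) +
        κ * ∫ y, R.indicator 1 y.1 ∂(roundKernel br π t h) := by
  have hind : Measurable fun f : Contract m => R.indicator (1 : Contract m → ℝ) f :=
    measurable_one.indicator hR
  have hindb : ∀ f : Contract m, |R.indicator (1 : Contract m → ℝ) f| ≤ 1 := fun f => by
    by_cases hf : f ∈ R <;> simp [hf]
  have hexpb : ∀ y, |Real.exp (g y)| ≤ Real.exp 1 := fun y => by
    rw [abs_of_pos (Real.exp_pos _)]; exact Real.exp_le_exp.2 (h1 y)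
  set Z := ∫ y, Real.exp (g y) ∂(roundKernel br' π t h) with hZ
  have hmeas : ∀ {J : ContractInstance m} (b : J.BestResponse) {g : Contract m × Outcome m → ℝ},
      Measurable g → Measurable fun f => ∑ o, (J.prod (b.act f) o).toReal * g (f, o) := by
    intro J b g hg
    refine Finset.measurable_sum _ fun o _ => Measurable.mul ?_ (hg.comp (by fun_prop))
    have := (b.outcomeKernel.measurable_coe (MeasurableSet.singleton o)).ennreal_toReal
    convert this using 2 with f
    change _ = ((J.prod (b.act f)).toMeasure {o}).toReal
    rw [PMF.toMeasure_apply_singleton _ _ (MeasurableSet.singleton o)]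
  have hbd : ∀ {J : ContractInstance m} (b : J.BestResponse) {g : Contract m × Outcome m → ℝ}
      (C : ℝ), (∀ y, |g y| ≤ C) → ∀ f, |∑ o, (J.prod (b.act f) o).toReal * g (f, o)| ≤ C := by
    intro J b g C hC f
    calc _ ≤ ∑ o, |(J.prod (b.act f) o).toReal * g (f, o)| := Finset.abs_sum_le_sum_abs _ _
      _ ≤ ∑ o, (J.prod (b.act f) o).toReal * C := Finset.sum_le_sum fun o _ => by
          rw [abs_mul, abs_of_nonneg ENNReal.toReal_nonneg]
          exact mul_le_mul_of_nonneg_left (hC _) ENNReal.toReal_nonneg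
      _ = C := by rw [← Finset.sum_mul, sum_toReal_eq_one, one_mul]
  have hY1 : ∀ f, 1 ≤ ∑ o, (I'.prod (br'.act f) o).toReal * Real.exp (g (f, o)) := fun f => by
    rw [← sum_toReal_eq_one (I'.prod (br'.act f))]
    exact Finset.sum_le_sum fun o _ =>
      le_mul_of_one_le_right ENNReal.toReal_nonneg (Real.one_le_exp (h0 _))
  have hZ' := integral_roundKernel br' π t h (g := fun y => Real.exp (g y)) hg.exp _ hexpb
  rw [← hZ] at hZ'
  have hiY : Integrable (fun f => ∑ o, (I'.prod (br'.act f) o).toReal * Real.exp (g (f, o)))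
      (π.query t h) := integrable_of_abs_le (hmeas br' (g := fun y => Real.exp (g y)) hg.exp) _
        (hbd br' (g := fun y => Real.exp (g y)) _ hexpb)
  have hZ1 : 1 ≤ Z := by
    rw [hZ']
    calc (1 : ℝ) = ∫ _, 1 ∂(π.query t h) := by simp
      _ ≤ _ := integral_mono (integrable_const _) hiY hY1
  have hZpos : 0 < Z := by linarith
  have hgb : ∀ y, |g y| ≤ 1 := fun y => by rw [abs_of_nonneg (h0 y)]; exact h1 y
  rw [integral_roundKernel br π t h hg 1 hgb,
    integral_roundKernel br π t h (g := fun y => R.indicator 1 y.1) (hind.comp measurable_fst) 1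
      fun y => hindb _]
  simp only [← Finset.sum_mul, sum_toReal_eq_one, one_mul]
  have hiR : Integrable (fun f : Contract m => R.indicator (1 : Contract m → ℝ) f)
    (π.query t h) := integrable_of_abs_le hind 1 hindb
  -- Jensen's inequality for the logarithm in tangent form, `log Y ≤ log Z - 1 + Y / Z`. The law of
  -- the contract given the history is the same in both instances, so the average of `Y` is exactly
  -- `Z`.
  calc ∫ f, ∑ o, (I.prod (br.act f) o).toReal * g (f, o) ∂(π.query t h)
      ≤ ∫ f, ((Real.log Z - 1 + Z⁻¹ * ∑ o, (I'.prod (br'.act f) o).toReal * Real.exp (g (f, o)))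
          + κ * R.indicator 1 f) ∂(π.query t h) := by
        refine integral_mono (integrable_of_abs_le (hmeas br hg) 1 (hbd br 1 hgb))
          (((integrable_const _).add (hiY.const_mul _)).add (hiR.const_mul _)) fun f => ?_
        refine (hdv f fun o => g (f, o)).trans ?_
        gcongr
        have hpos : 0 < ∑ o, (I'.prod (br'.act f) o).toReal * Real.exp (g (f, o)) := by
          linarith [hY1 f]
        have := Real.log_le_sub_one_of_pos (mul_pos (inv_pos.2 hZpos) hpos)
        rw [Real.log_mul (inv_pos.2 hZpos).ne' hpos.ne', Real.log_inv] at this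
        linarith
    _ = Real.log Z + κ * ∫ f, R.indicator 1 f ∂(π.query t h) := by
        have hi : Integrable (fun f => Real.log Z - 1 +
            Z⁻¹ * ∑ o, (I'.prod (br'.act f) o).toReal * Real.exp (g (f, o))) (π.query t h) :=
          (integrable_const _).add (hiY.const_mul _)
        rw [integral_add hi (hiR.const_mul _),
          integral_add (integrable_const _) (hiY.const_mul _), integral_const_mul,
          integral_const_mul, ← hZ', inv_mul_cancel₀ hZpos.ne']
        simp

/-- Change of measure for the histories of two instances whose outcome laws agree off `R` and have
divergence at most `κ` on `R`. -/
lemma integral_historyLaw_le {I I' : ContractInstance m} (br : I.BestResponse)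
    (br' : I'.BestResponse) (π : Policy m) {R : Set (Contract m)}
    (hR : MeasurableSet R) {κ : ℝ}
    (hdv : ∀ f (G : Outcome m → ℝ), ∑ o, (I.prod (br.act f) o).toReal * G o ≤
      Real.log (∑ o, (I'.prod (br'.act f) o).toReal * Real.exp (G o)) +
        κ * R.indicator 1 f) (t : ℕ) :
    ∀ {G : History m t → ℝ}, Measurable G → (∀ h, 0 ≤ G h) → (∀ h, G h ≤ 1) →
      ∫ h, G h ∂(historyLaw br π t) ≤ ∫ h, (Real.exp (G h) - 1) ∂(historyLaw br' π t) +
        κ * ∫ h, ∑ s, R.indicator 1 (h s).1 ∂(historyLaw br π t) := by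
  have hind : Measurable fun f : Contract m => R.indicator (1 : Contract m → ℝ) f :=
    measurable_one.indicator hR
  have hindb : ∀ f : Contract m, |R.indicator (1 : Contract m → ℝ) f| ≤ 1 := fun f => by
    by_cases hf : f ∈ R <;> simp [hf]
  have hcount : ∀ t, Measurable fun h : History m t =>
      ∑ s, R.indicator (1 : Contract m → ℝ) (h s).1 := fun t =>
    Finset.measurable_sum _ fun s _ => hind.comp (measurable_fst.comp (measurable_pi_apply s))
  have hcountb : ∀ t (h : History m t), |∑ s, R.indicator (1 : Contract m → ℝ) (h s).1| ≤ t :=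
    fun t h => by
      calc _ ≤ ∑ s, |R.indicator (1 : Contract m → ℝ) (h s).1| := Finset.abs_sum_le_sum_abs _ _
        _ ≤ ∑ _s : Fin t, (1 : ℝ) := Finset.sum_le_sum fun s _ => hindb _
        _ = t := by simp
  induction t with
  | zero =>
    intro G hG h0 h1
    have : ∀ h : History m 0, G h ≤ Real.exp (G h) - 1 := fun h => by
      linarith [Real.add_one_le_exp (G h)]
    simp only [historyLaw, integral_dirac]
    simpa using this _
  | succ t ih =>
    intro G hG h0 h1
    have hGb : ∀ h, |G h| ≤ 1 := fun h => by rw [abs_of_nonneg (h0 h)]; exact h1 h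
    have hexpb : ∀ h, |Real.exp (G h)| ≤ Real.exp 1 := fun h => by
      rw [abs_of_pos (Real.exp_pos _)]; exact Real.exp_le_exp.2 (h1 h)
    have hsn : ∀ h : History m t, Measurable fun y : Contract m × Outcome m =>
        (Fin.snoc h y : History m (t + 1)) := fun h =>
      (measurable_snoc m t).comp measurable_prodMk_left
    set Z : History m t → ℝ := fun h =>
      ∫ y, Real.exp (G (Fin.snoc h y)) ∂(roundKernel br' π t h) with hZ
    have hZm : Measurable Z :=
      (StronglyMeasurable.integral_kernel_prod_right' (κ := roundKernel br' π t)
        (f := fun x => Real.exp (G (Fin.snoc x.1 x.2)))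
        (hG.comp (measurable_snoc m t)).exp.stronglyMeasurable).measurable
    have hiexp : ∀ h, Integrable (fun y => Real.exp (G (Fin.snoc h y))) (roundKernel br' π t h) :=
      fun h => integrable_of_abs_le (hG.comp (hsn h)).exp (Real.exp 1) fun y => hexpb _
    have hZ1 : ∀ h, 1 ≤ Z h := fun h => by
      calc (1 : ℝ) = ∫ _, 1 ∂(roundKernel br' π t h) := by simp
        _ ≤ _ := integral_mono (integrable_const _) (hiexp h) fun y => Real.one_le_exp (h0 _)
    have hZe : ∀ h, Z h ≤ Real.exp 1 := fun h => by
      calc Z h ≤ ∫ _, Real.exp 1 ∂(roundKernel br' π t h) :=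
            integral_mono (hiexp h) (integrable_const _) fun y => Real.exp_le_exp.2 (h1 _)
        _ = _ := by simp
    -- The chain rule: the last round is absorbed into `log Z`, which again takes values in `[0,
    -- 1]`. The exponential in the induction hypothesis turns it back into `Z`, whose integral is
    -- that of `exp G` over one more round.
    have hih := ih (G := fun h => Real.log (Z h)) hZm.log
      (fun h => Real.log_nonneg (hZ1 h)) fun h => by
        rw [Real.log_le_iff_le_exp (by linarith [hZ1 h])]; exact hZe h
    simp only [fun h => Real.exp_log (show 0 < Z h by linarith [hZ1 h])] at hih
    have hZint : Integrable Z (historyLaw br' π t) := integrable_of_abs_le hZm (Real.exp 1)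
      fun h => by rw [abs_of_pos (by linarith [hZ1 h])]; exact hZe h
    have hexpint : Integrable (fun h => Real.exp (G h)) (historyLaw br' π (t + 1)) :=
      integrable_of_abs_le hG.exp _ hexpb
    rw [integral_sub hZint (integrable_const _)] at hih
    rw [integral_sub hexpint (integrable_const _),
      integral_historyLaw_succ br' π t hG.exp _ hexpb, integral_historyLaw_succ br π t hG 1 hGb,
      integral_historyLaw_succ br π t (hcount (t + 1)) (t + 1 : ℕ) (hcountb (t + 1))]
    simp only [Fin.sum_univ_castSucc, Fin.snoc_castSucc, Fin.snoc_last]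
    set ν := fun h => ∫ y, R.indicator (1 : Contract m → ℝ) y.1 ∂(roundKernel br π t h) with hν
    have hνm : Measurable ν :=
      (StronglyMeasurable.integral_kernel_prod_right' (κ := roundKernel br π t)
        (f := fun x : History m t × (Contract m × Outcome m) => R.indicator 1 x.2.1)
        (hind.comp (measurable_fst.comp measurable_snd)).stronglyMeasurable).measurable
    have hνb : ∀ h, |ν h| ≤ 1 := fun h => by
      have := norm_integral_le_of_norm_le_const (μ := roundKernel br π t h)
        (f := fun y => R.indicator (1 : Contract m → ℝ) y.1) (C := 1)
        (.of_forall fun y => hindb _)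
      simpa using this
    have hadd : ∀ h : History m t,
        ∫ y, (∑ s, R.indicator (1 : Contract m → ℝ) (h s).1 + R.indicator 1 y.1)
          ∂(roundKernel br π t h) = ∑ s, R.indicator (1 : Contract m → ℝ) (h s).1 + ν h := by
      intro h
      have hi : Integrable (fun y : Contract m × Outcome m =>
          R.indicator (1 : Contract m → ℝ) y.1) (roundKernel br π t h) :=
        integrable_of_abs_le (hind.comp measurable_fst) 1 fun y => hindb _
      rw [integral_add (integrable_const _) hi]
      simp [hν]
    simp only [hadd]
    have hνint : Integrable ν (historyLaw br π t) := integrable_of_abs_le hνm 1 hνb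
    rw [integral_add (integrable_of_abs_le (hcount t) t (hcountb t)) hνint]
    have hlogint : Integrable (fun h => Real.log (Z h)) (historyLaw br π t) :=
      integrable_of_abs_le hZm.log 1 fun h => by
        rw [abs_of_nonneg (Real.log_nonneg (hZ1 h)),
          Real.log_le_iff_le_exp (by linarith [hZ1 h])]
        exact hZe h
    have hstep : ∫ h, ∫ y, G (Fin.snoc h y) ∂(roundKernel br π t h) ∂(historyLaw br π t) ≤
        ∫ h, (Real.log (Z h) + κ * ν h) ∂(historyLaw br π t) := by
      refine integral_mono_of_nonneg (.of_forall fun h => integral_nonneg fun y => h0 _)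
        (hlogint.add (hνint.const_mul _)) (.of_forall fun h => ?_)
      exact integral_roundKernel_le br br' π t h hR hdv (hG.comp (hsn h)) (fun y => h0 _)
        fun y => h1 _
    rw [integral_add hlogint (hνint.const_mul _), integral_const_mul] at hstep
    simp only [integral_const, probReal_univ, smul_eq_mul, mul_one] at hih ⊢
    linarith

end OnlineContract

noncomputable section

namespace OnlineContract

/-! ### Effort levels for a single coordinate

Level `l` has slope `l / (4 n)`; the agent is indifferent between the levels `l - 1` and `l` at the
payment `breakpoint n l`. -/

/-- The payment at which level `l` becomes attractive. -/
def breakpoint (n l : ℕ) : ℝ := if l ≤ n then l / (2 * n) else 1 - n / (2 * l)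

/-- The cost of level `l`. -/
def levelCost (n l : ℕ) : ℝ := 1 / (4 * n) * ∑ j ∈ Finset.range l, breakpoint n (j + 1)

/-- The agent's payoff from level `l` under the payment `x`. -/
def levelPayoff (n l : ℕ) (x : ℝ) : ℝ :=
  1 / (4 * n) * ∑ j ∈ Finset.range l, (x - breakpoint n (j + 1))

lemma levelPayoff_eq (n l : ℕ) (x : ℝ) :
    levelPayoff n l x = l / (4 * n) * x - levelCost n l := by
  simp only [levelPayoff, levelCost, Finset.sum_sub_distrib, Finset.sum_const, Finset.card_range,
    nsmul_eq_mul]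
  ring

lemma levelPayoff_succ (n l : ℕ) (x : ℝ) :
    levelPayoff n (l + 1) x = levelPayoff n l x + 1 / (4 * n) * (x - breakpoint n (l + 1)) := by
  simp only [levelPayoff, Finset.sum_range_succ]
  ring

variable {n : ℕ}

lemma breakpoint_of_ge (hn : 0 < n) {l : ℕ} (hl : n ≤ l) :
    breakpoint n l = 1 - n / (2 * l) := by
  unfold breakpoint
  split_ifs with h
  · obtain rfl : l = n := le_antisymm h hl
    have : (l : ℝ) ≠ 0 := by positivity
    field_simp
    norm_num
  · rfl

/-- In the lower half the spacing is `1 / (2 n)`; in the upper half it is `n / (2 l (l + 1))`, and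
`l (l + 1) ≤ 4 n²`. This uniform convexity of the cost makes the agent's response stable under a
small rebate. -/
lemma breakpoint_step (hn : 0 < n) {l : ℕ} (hl : l + 1 ≤ 2 * n) :
    breakpoint n l + 1 / (8 * n) ≤ breakpoint n (l + 1) := by
  have hn' : (0 : ℝ) < n := by positivity
  rcases Nat.lt_or_ge l n with h | h
  · rw [breakpoint, breakpoint, if_pos h.le, if_pos (by omega)]
    push_cast
    have : (l : ℝ) / (2 * n) + 1 / (8 * n) + 3 / (8 * n) = (l + 1) / (2 * n) := by
      field_simp; ring
    have h3 : (0 : ℝ) ≤ 3 / (8 * n) := by positivity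
    linarith
  · rw [breakpoint_of_ge hn h, breakpoint_of_ge hn (by omega)]
    have hl0 : (0 : ℝ) < l := by
      have : 0 < l := by omega
      positivity
    have hl' : (l : ℝ) + 1 ≤ 2 * n := by exact_mod_cast hl
    push_cast
    have : (n : ℝ) / (2 * l) - n / (2 * (l + 1)) = n / (2 * (l * (l + 1))) := by
      field_simp; ring
    have h2 : 1 / (8 * (n : ℝ)) ≤ n / (2 * (l * (l + 1))) := by
      rw [div_le_div_iff₀ (by positivity) (by positivity)]
      nlinarith
    linarith

lemma breakpoint_add (hn : 0 < n) (a d : ℕ) (h : a + d ≤ 2 * n) :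
    breakpoint n a + d / (8 * n) ≤ breakpoint n (a + d) := by
  induction d with
  | zero => simp
  | succ d ih =>
    have h1 := ih (by omega)
    have h2 := breakpoint_step hn (l := a + d) (by omega)
    rw [← add_assoc]
    push_cast
    rw [add_div]
    linarith

lemma breakpoint_nonneg (hn : 0 < n) {l : ℕ} (hl : l ≤ 2 * n) : 0 ≤ breakpoint n l := by
  have := breakpoint_add hn 0 l (by omega)
  have h0 : breakpoint n 0 = 0 := by simp [breakpoint]
  rw [h0, zero_add, zero_add] at this
  exact le_trans (by positivity) this

lemma breakpoint_lt_one (hn : 0 < n) (l : ℕ) : breakpoint n l < 1 := by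
  have hn' : (0 : ℝ) < n := by positivity
  unfold breakpoint
  split_ifs with h
  · rw [div_lt_one (by positivity)]
    have : (l : ℝ) ≤ n := by exact_mod_cast h
    linarith
  · have : 0 < l := by omega
    have : (0 : ℝ) < n / (2 * l) := by positivity
    linarith

lemma half_le_breakpoint (hn : 0 < n) {l : ℕ} (hl : n ≤ l) : 1 / 2 ≤ breakpoint n l := by
  rw [breakpoint_of_ge hn hl]
  have hl0 : (0 : ℝ) < l := by
    have : 0 < l := by omega
    positivity
  have : (n : ℝ) ≤ l := by exact_mod_cast hl
  have h2 : (n : ℝ) / (2 * l) ≤ 1 / 2 := by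
    rw [div_le_div_iff₀ (by positivity) (by positivity)]; linarith
  linarith

lemma slope_mul_breakpoint_le (hn : 0 < n) (l : ℕ) :
    (l : ℝ) / (4 * n) * (1 - breakpoint n l) ≤ 1 / 8 := by
  have hn' : (0 : ℝ) < n := by positivity
  unfold breakpoint
  split_ifs with h
  · rw [show (l : ℝ) / (4 * n) * (1 - l / (2 * n)) = l * (2 * n - l) / (8 * n ^ 2) by
        field_simp; ring,
      div_le_div_iff₀ (by positivity) (by positivity)]
    nlinarith [sq_nonneg ((l : ℝ) - n)]
  · have : 0 < l := by omega
    apply le_of_eq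
    field_simp
    ring

/-- The upper breakpoints are defined by this equation: without a rebate all upper levels are
equally profitable, so the base instance does not favour any candidate. -/
lemma slope_mul_breakpoint (hn : 0 < n) {l : ℕ} (hl : n ≤ l) :
    (l : ℝ) / (4 * n) * (1 - breakpoint n l) = 1 / 8 := by
  have hn' : (0 : ℝ) < n := by positivity
  have hl0 : (0 : ℝ) < l := by
    have : 0 < l := by omega
    positivity
  rw [breakpoint_of_ge hn hl]
  field_simp
  ring

lemma levelCost_nonneg (hn : 0 < n) {l : ℕ} (hl : l ≤ 2 * n) : 0 ≤ levelCost n l :=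
  mul_nonneg (by positivity) <| Finset.sum_nonneg fun j hj =>
    breakpoint_nonneg hn (by have := Finset.mem_range.1 hj; omega)

lemma levelCost_le_one (hn : 0 < n) {l : ℕ} (hl : l ≤ 2 * n) : levelCost n l ≤ 1 := by
  have hn' : (0 : ℝ) < n := by positivity
  have h1 : ∑ j ∈ Finset.range l, breakpoint n (j + 1) ≤ ∑ _j ∈ Finset.range l, (1 : ℝ) :=
    Finset.sum_le_sum fun j _ => (breakpoint_lt_one hn _).le
  have h2 : (l : ℝ) ≤ 2 * n := by exact_mod_cast hl
  simp only [Finset.sum_const, Finset.card_range, nsmul_eq_mul, mul_one] at h1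
  rw [levelCost, one_div, inv_mul_le_iff₀ (by positivity)]
  linarith

lemma le_levelCost (hn : 0 < n) {l : ℕ} (hnl : n ≤ l) (hl : l ≤ 2 * n) :
    1 / (8 * n) ≤ levelCost n l := by
  have h1 : breakpoint n (n - 1 + 1) ≤ ∑ j ∈ Finset.range l, breakpoint n (j + 1) :=
    Finset.single_le_sum (f := fun j => breakpoint n (j + 1))
      (fun j hj => breakpoint_nonneg hn (by have := Finset.mem_range.1 hj; omega))
      (Finset.mem_range.2 (by omega))
  rw [show n - 1 + 1 = n by omega] at h1
  have h2 := half_le_breakpoint hn le_rfl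
  have hn' : (0 : ℝ) < n := by positivity
  calc 1 / (8 * (n : ℝ)) = 1 / (4 * n) * (1 / 2) := by field_simp; norm_num
    _ ≤ levelCost n l := by unfold levelCost; gcongr; linarith

/-! ### Quadratic loss of suboptimal levels -/

lemma natCast_mul_sub_one_nonneg (d : ℕ) : (0 : ℝ) ≤ d * (d - 1) := by
  rcases d with _ | d
  · simp
  · push_cast; simp only [add_sub_cancel_right]; positivity

/-- The step past level `a + j` loses at least `j / (8 n)` times the slope increment `1 / (4 n)`;
these losses add up to the triangular number. The form `d * (d - 1)` instead of `d ^ 2` is forced by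
ties: at a breakpoint the adjacent level loses nothing. -/
lemma levelPayoff_sub_of_le (hn : 0 < n) (a d : ℕ) {x : ℝ} (h : a + d ≤ 2 * n)
    (hx : x ≤ breakpoint n (a + 1)) :
    d * (d - 1) / (64 * n ^ 2) ≤ levelPayoff n a x - levelPayoff n (a + d) x := by
  have hn' : (0 : ℝ) < n := by positivity
  induction d with
  | zero => simp
  | succ d ih =>
    have h1 := ih (by omega)
    have h2 := breakpoint_add hn (a + 1) d (by omega)
    rw [← add_assoc, levelPayoff_succ]
    rw [show a + 1 + d = a + d + 1 by ring] at h2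
    have h3 : 1 / (4 * (n : ℝ)) * (d / (8 * n)) ≤
        1 / (4 * n) * (breakpoint n (a + d + 1) - x) := by gcongr; linarith
    have h4 : ((d + 1 : ℕ) : ℝ) * ((d + 1 : ℕ) - 1) / (64 * n ^ 2) =
        d * (d - 1) / (64 * n ^ 2) + 1 / (4 * n) * (d / (8 * n)) := by
      push_cast; field_simp; ring
    rw [h4]
    linarith

lemma levelPayoff_sub_of_ge (hn : 0 < n) (d : ℕ) {x : ℝ} : ∀ (k : ℕ), k + d ≤ 2 * n →
    breakpoint n (k + d) ≤ x →
    d * (d - 1) / (64 * n ^ 2) ≤ levelPayoff n (k + d) x - levelPayoff n k x := by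
  have hn' : (0 : ℝ) < n := by positivity
  induction d with
  | zero => simp
  | succ d ih =>
    intro k h hx
    rw [show k + (d + 1) = k + 1 + d by ring] at hx h ⊢
    have h1 := ih (k + 1) h hx
    have h2 := breakpoint_add hn (k + 1) d h
    rw [levelPayoff_succ] at h1
    have h3 : 1 / (4 * (n : ℝ)) * (d / (8 * n)) ≤
        1 / (4 * n) * (x - breakpoint n (k + 1)) := by gcongr; linarith
    have h4 : ((d + 1 : ℕ) : ℝ) * ((d + 1 : ℕ) - 1) / (64 * n ^ 2) =
        d * (d - 1) / (64 * n ^ 2) + 1 / (4 * n) * (d / (8 * n)) := by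
      push_cast; field_simp; ring
    rw [h4]
    linarith

open Classical in
/-- The level that the agent chooses under the payment `x`. -/
def level (n : ℕ) (x : ℝ) : ℕ := Nat.findGreatest (fun l => breakpoint n l ≤ x) (2 * n - 1)

lemma level_lt (hn : 0 < n) (x : ℝ) : level n x < 2 * n := by
  classical
  have := Nat.findGreatest_le (P := fun l => breakpoint n l ≤ x) (2 * n - 1)
  unfold level
  omega

/-- Level zero has to be excluded because it is also the default value of the search when `x` is
negative, which relative payments can be. -/
lemma breakpoint_level_le {x : ℝ} (h : level n x ≠ 0) : breakpoint n (level n x) ≤ x := by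
  classical
  exact Nat.findGreatest_of_ne_zero (P := fun l => breakpoint n l ≤ x) rfl h

lemma lt_breakpoint_of_level_lt {x : ℝ} {l : ℕ} (h : level n x < l) (hl : l < 2 * n) :
    x < breakpoint n l := by
  classical
  exact not_le.1 (Nat.findGreatest_is_greatest (P := fun l => breakpoint n l ≤ x) h (by omega))

/-- The number of levels between `a` and `b`. -/
def levelDist (a b : ℕ) : ℕ := (a - b) + (b - a)

lemma levelDist_mul_le (hn : 0 < n) {l : ℕ} (hl : l < 2 * n) (x : ℝ) :
    (levelDist l (level n x) : ℝ) * (levelDist l (level n x) - 1) / (64 * n ^ 2) ≤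
      levelPayoff n (level n x) x - levelPayoff n l x := by
  rcases lt_trichotomy l (level n x) with h | h | h
  · obtain ⟨d, hd⟩ := Nat.exists_eq_add_of_lt h
    have h2 := level_lt hn x
    have h3 := levelPayoff_sub_of_ge hn (d + 1) (x := x) l (by omega)
      (by rw [← add_assoc, ← hd]; exact breakpoint_level_le (by omega))
    rw [← add_assoc, ← hd] at h3
    rwa [show levelDist l (level n x) = d + 1 by unfold levelDist; omega]
  · rw [show levelDist l (level n x) = 0 by unfold levelDist; omega, ← h]
    simp
  · obtain ⟨d, hd⟩ := Nat.exists_eq_add_of_lt h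
    have h3 := levelPayoff_sub_of_le hn (level n x) (d + 1) (x := x) (by omega)
      (lt_breakpoint_of_level_lt (by omega) (by omega)).le
    rw [← add_assoc, ← hd] at h3
    rwa [show levelDist l (level n x) = d + 1 by unfold levelDist; omega]

lemma levelPayoff_le_level (hn : 0 < n) {l : ℕ} (hl : l < 2 * n) (x : ℝ) :
    levelPayoff n l x ≤ levelPayoff n (level n x) x := by
  have h1 := levelDist_mul_le hn hl x
  have h2 := natCast_mul_sub_one_nonneg (levelDist l (level n x))
  have h3 := div_nonneg h2 (by positivity : (0 : ℝ) ≤ 64 * n ^ 2)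
  linarith

/-- Ties between levels are in favour of `level n x` from the principal's point of view. -/
lemma slope_mul_le_of_levelPayoff_eq (hn : 0 < n) {l : ℕ} (hl : l < 2 * n) {x : ℝ}
    (h : levelPayoff n l x = levelPayoff n (level n x) x) :
    (l : ℝ) / (4 * n) * (1 - x) ≤ level n x / (4 * n) * (1 - x) ∧
      (l ≠ level n x → (l : ℝ) / (4 * n) * (1 - x) < level n x / (4 * n) * (1 - x)) := by
  have hn' : (0 : ℝ) < n := by positivity
  rcases lt_trichotomy l (level n x) with h1 | h1 | h1
  · suffices hx : x < 1 by
      have h2 : (l : ℝ) < level n x := by exact_mod_cast h1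
      have : (l : ℝ) / (4 * n) * (1 - x) < level n x / (4 * n) * (1 - x) := by
        have : 0 < 1 - x := by linarith
        gcongr
      exact ⟨this.le, fun _ => this⟩
    -- A payment of at least one exceeds every breakpoint strictly, so the higher level would be
    -- strictly better and there would be no tie.
    by_contra! hx
    obtain ⟨d, hd⟩ := Nat.exists_eq_add_of_lt h1
    have hlt := level_lt hn x
    have h3 := levelPayoff_sub_of_ge hn d (x := x) (l + 1) (by omega)
      (by rw [show l + 1 + d = level n x by omega]; exact breakpoint_level_le (by omega))
    rw [show l + 1 + d = level n x by omega, levelPayoff_succ] at h3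
    have h4 := div_nonneg (natCast_mul_sub_one_nonneg d) (by positivity : (0 : ℝ) ≤ 64 * n ^ 2)
    have h5 : 0 < 1 / (4 * (n : ℝ)) * (x - breakpoint n (l + 1)) :=
      mul_pos (by positivity) (by linarith [breakpoint_lt_one hn (l + 1)])
    linarith
  · exact ⟨by rw [← h1], fun h => absurd h1 h⟩
  -- Levels above the chosen one are strictly worse, since `x` lies strictly below the next
  -- breakpoint.
  · exfalso
    obtain ⟨d, hd⟩ := Nat.exists_eq_add_of_lt h1
    have hx := lt_breakpoint_of_level_lt (n := n) (x := x) (l := level n x + 1) (by omega)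
      (by omega)
    have h6 : breakpoint n (level n x + 1) ≤ breakpoint n (level n x + 1 + 1) := by
      have := breakpoint_step hn (l := level n x + 1) (by omega)
      have : (0 : ℝ) ≤ 1 / (8 * n) := by positivity
      linarith
    have h3 := levelPayoff_sub_of_le hn (level n x + 1) d (x := x) (by omega) (by linarith)
    rw [show level n x + 1 + d = l by omega, levelPayoff_succ] at h3
    have h4 := div_nonneg (natCast_mul_sub_one_nonneg d) (by positivity : (0 : ℝ) ≤ 64 * n ^ 2)
    have h5 : 0 < 1 / (4 * (n : ℝ)) * (breakpoint n (level n x + 1) - x) :=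
      mul_pos (by positivity) (by linarith)
    linarith

lemma slope_level_mul_le (hn : 0 < n) (x : ℝ) : (level n x : ℝ) / (4 * n) * (1 - x) ≤ 1 / 8 := by
  by_cases h : level n x = 0
  · simp [h]
  · refine le_trans ?_ (slope_mul_breakpoint_le hn (level n x))
    have := breakpoint_level_le h
    gcongr

/-- Just below its breakpoint a level loses little against any other one. -/
lemma levelPayoff_le_add (hn : 0 < n) {k : ℕ} (hk : 0 < k) (hk2 : k < 2 * n) {l : ℕ}
    (hl : l < 2 * n) :
    levelPayoff n l (breakpoint n k - 1 / (8 * n)) ≤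
      levelPayoff n k (breakpoint n k - 1 / (8 * n)) + 1 / (32 * n ^ 2) := by
  have hn' : (0 : ℝ) < n := by positivity
  set x := breakpoint n k - 1 / (8 * n) with hx
  obtain ⟨a, rfl⟩ : ∃ a, k = a + 1 := ⟨k - 1, by omega⟩
  have hpos : (0 : ℝ) < 1 / (8 * n) := by positivity
  have hstep := breakpoint_step hn (l := a) (by omega)
  -- At this payment level `a = k - 1` is optimal, and it beats `k` by the slope increment `1 / (4
  -- n)` times the shortfall `1 / (8 n)`. This product is the size of the rebate.
  have h1 : levelPayoff n (a + 1) x + 1 / (32 * n ^ 2) = levelPayoff n a x := by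
    rw [levelPayoff_succ, hx]; field_simp; ring
  rw [h1]
  rcases le_total a l with h | h
  · obtain ⟨d, rfl⟩ := Nat.exists_eq_add_of_le h
    have h3 := levelPayoff_sub_of_le hn a d (x := x) (by omega) (by linarith)
    have h4 := div_nonneg (natCast_mul_sub_one_nonneg d) (by positivity : (0 : ℝ) ≤ 64 * n ^ 2)
    linarith
  · obtain ⟨d, rfl⟩ := Nat.exists_eq_add_of_le h
    have h3 := levelPayoff_sub_of_ge hn d (x := x) l (by omega) (by linarith)
    have h4 := div_nonneg (natCast_mul_sub_one_nonneg d) (by positivity : (0 : ℝ) ≤ 64 * n ^ 2)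
    linarith

/-! ### Instances with a hidden profitable action -/

variable {m : ℕ}

/-- The weights of the outcomes under the efforts `s`. -/
def outcomeWeight (s : Fin m → ℝ) : Outcome m → ℝ :=
  Fin.cons (1 - (∑ i, s i) / m) fun i => s i / m

lemma sum_div_nonneg {s : Fin m → ℝ} (h : ∀ i, 0 ≤ s i) : 0 ≤ (∑ i, s i) / m :=
  div_nonneg (Finset.sum_nonneg fun i _ => h i) (by positivity)

lemma sum_div_le_of_le {s : Fin m → ℝ} {C : ℝ} (hC : 0 ≤ C) (h : ∀ i, s i ≤ C) :
    (∑ i, s i) / m ≤ C := by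
  rcases Nat.eq_zero_or_pos m with rfl | hm
  · simpa using hC
  rw [div_le_iff₀ (by positivity)]
  calc ∑ i, s i ≤ ∑ _i : Fin m, C := Finset.sum_le_sum fun i _ => h i
    _ = C * m := by simp [mul_comm]

lemma le_sum_div_of_le (hm : 0 < m) {s : Fin m → ℝ} {C : ℝ} (h : ∀ i, C ≤ s i) :
    C ≤ (∑ i, s i) / m := by
  rw [le_div_iff₀ (by positivity)]
  calc C * m = ∑ _i : Fin m, C := by simp [mul_comm]
    _ ≤ ∑ i, s i := Finset.sum_le_sum fun i _ => h i

lemma outcomeWeight_nonneg {s : Fin m → ℝ} (h0 : ∀ i, 0 ≤ s i) (h1 : ∀ i, s i ≤ 1)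
    (o : Outcome m) : 0 ≤ outcomeWeight s o := by
  refine Fin.cases ?_ (fun i => ?_) o
  · simpa [outcomeWeight] using sum_div_le_of_le zero_le_one h1
  · simpa [outcomeWeight] using div_nonneg (h0 i) (by positivity)

lemma sum_outcomeWeight (s : Fin m → ℝ) : ∑ o, outcomeWeight s o = 1 := by
  simp [outcomeWeight, Fin.sum_univ_succ, ← Finset.sum_div]

/-- The law of the outcome under the efforts `s`. -/
def outcomeLaw (s : Fin m → ℝ) (h0 : ∀ i, 0 ≤ s i) (h1 : ∀ i, s i ≤ 1) : PMF (Outcome m) :=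
  PMF.ofFintype (fun o => ENNReal.ofReal (outcomeWeight s o)) (by
    rw [← ENNReal.ofReal_sum_of_nonneg fun o _ => outcomeWeight_nonneg h0 h1 o,
      sum_outcomeWeight, ENNReal.ofReal_one])

lemma toReal_outcomeLaw (s : Fin m → ℝ) (h0 : ∀ i, 0 ≤ s i) (h1 : ∀ i, s i ≤ 1)
    (o : Outcome m) : (outcomeLaw s h0 h1 o).toReal = outcomeWeight s o := by
  simp [outcomeLaw, ENNReal.toReal_ofReal (outcomeWeight_nonneg h0 h1 o)]

/-- The effort in coordinate `i` under the action `a`. -/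
def effort (a : Fin m → Fin (2 * n)) (i : Fin m) : ℝ := (a i : ℕ) / (4 * n)

lemma effort_nonneg (a : Fin m → Fin (2 * n)) (i : Fin m) : 0 ≤ effort a i := by
  unfold effort; positivity

lemma effort_le_half (a : Fin m → Fin (2 * n)) (i : Fin m) : effort a i ≤ 1 / 2 := by
  have hn : 0 < n := by have := (a i).2; omega
  have h : ((a i : ℕ) : ℝ) ≤ 2 * n := by exact_mod_cast (a i).2.le
  unfold effort
  rw [div_le_div_iff₀ (by positivity) (by positivity)]
  linarith

/-- The cost of the action `a`, before the rebate. -/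
def actionCost (a : Fin m → Fin (2 * n)) : ℝ := (∑ i, levelCost n (a i)) / m

lemma actionCost_nonneg (a : Fin m → Fin (2 * n)) : 0 ≤ actionCost a :=
  sum_div_nonneg fun i => levelCost_nonneg (by have := (a i).2; omega) (a i).2.le

open Classical in
/-- The instance whose actions are vectors of levels, with a rebate `r` on the cost of `k`. -/
def rebateInstance (hn : 0 < n) (k : Fin m → Fin (2 * n)) (r : ℝ) (hr : 0 ≤ r)
    (hk : r ≤ actionCost k) : ContractInstance m where
  Action := Fin m → Fin (2 * n)
  prod a := outcomeLaw (effort a) (effort_nonneg a) fun i => by linarith [effort_le_half a i]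
  cost a := actionCost a - if a = k then r else 0
  cost_nonneg a := by
    split_ifs with h
    · subst h; linarith
    · simpa using actionCost_nonneg a
  cost_le_one a := by
    have : actionCost a ≤ 1 :=
      sum_div_le_of_le zero_le_one fun i => levelCost_le_one hn (a i).2.le
    split_ifs <;> linarith
  nullAction := fun _ => ⟨0, by omega⟩
  cost_null := by
    have h0 : actionCost (fun _ : Fin m => (⟨0, by omega⟩ : Fin (2 * n))) = 0 := by
      simp [actionCost, levelCost]
    split_ifs with h
    -- If `k` is the null action itself, then `hk` forces the rebate to vanish.
    · rw [← h, h0] at hk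
      rw [h0]; linarith
    · rw [h0, sub_zero]
  prod_null := by
    ext o
    refine Fin.cases ?_ (fun i => ?_) o
    · simp [outcomeLaw, outcomeWeight, effort]
    · simp [outcomeLaw, outcomeWeight, effort]

/-- The payment for outcome `i + 1`, relative to the one for the null outcome. -/
def relPay (f : Contract m) (i : Fin m) : ℝ := (f i.succ : ℝ) - f 0

/-- The agent's utility from `a`, before the rebate and the payment for the null outcome. -/
def basePayoff (f : Contract m) (a : Fin m → Fin (2 * n)) : ℝ :=
  (∑ i, levelPayoff n (a i) (relPay f i)) / m

/-- The principal's utility from `a`. -/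
def baseProfit (f : Contract m) (a : Fin m → Fin (2 * n)) : ℝ :=
  (∑ i, effort a i * (1 - relPay f i)) / m - f 0

section
variable (hn : 0 < n) (k : Fin m → Fin (2 * n)) (r : ℝ) (hr : 0 ≤ r) (hk : r ≤ actionCost k)

lemma toReal_prod_rebateInstance (a : Fin m → Fin (2 * n)) (o : Outcome m) :
    ((rebateInstance hn k r hr hk).prod a o).toReal = outcomeWeight (effort a) o :=
  toReal_outcomeLaw (effort a) (effort_nonneg a) (fun i => by linarith [effort_le_half a i]) o

open Classical in
-- The payment for the null outcome acts as a lump sum, after which the problem separates into one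
-- level choice per coordinate.
lemma agentUtility_rebateInstance (f : Contract m) (a : Fin m → Fin (2 * n)) :
    (rebateInstance hn k r hr hk).agentUtility f a =
      f 0 + basePayoff f a + if a = k then r else 0 := by
  have h : ∀ i, levelPayoff n (a i) (relPay f i) =
      effort a i * f i.succ - effort a i * f 0 - levelCost n (a i) := fun i => by
    rw [levelPayoff_eq, relPay, effort]; ring
  unfold ContractInstance.agentUtility
  simp only [toReal_prod_rebateInstance]
  simp only [rebateInstance, basePayoff, h, Fin.sum_univ_succ, outcomeWeight, Fin.cons_zero,
    Fin.cons_succ, actionCost, Finset.sum_sub_distrib, ← Finset.sum_mul]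
  simp only [div_mul_eq_mul_div, ← Finset.sum_div]
  ring

lemma principalUtility_rebateInstance (f : Contract m) (a : Fin m → Fin (2 * n)) :
    (rebateInstance hn k r hr hk).principalUtility f a = baseProfit f a := by
  have h : ∀ i, effort a i * (1 - relPay f i) =
      effort a i * (1 - f i.succ) + effort a i * f 0 := fun i => by rw [relPay]; ring
  unfold ContractInstance.principalUtility
  simp only [toReal_prod_rebateInstance]
  simp only [baseProfit, h, Fin.sum_univ_succ, outcomeWeight, Fin.cons_zero, value,
    Fin.cons_succ, Finset.sum_add_distrib, ← Finset.sum_mul, Fin.succ_ne_zero, if_true, if_false]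
  simp only [div_mul_eq_mul_div, ← Finset.sum_div]
  ring

end

/-! ### The agent's response with and without rebate -/

/-- The agent's response to `f` when there is no rebate. -/
def levels (hn : 0 < n) (f : Contract m) (i : Fin m) : Fin (2 * n) :=
  ⟨level n (relPay f i), level_lt hn _⟩

lemma basePayoff_le_levels (hn : 0 < n) (f : Contract m) (a : Fin m → Fin (2 * n)) :
    basePayoff f a ≤ basePayoff f (levels hn f) :=
  div_le_div_of_nonneg_right
    (Finset.sum_le_sum fun i _ => levelPayoff_le_level hn (a i).2 _) (by positivity)

lemma baseProfit_levels_le (hn : 0 < n) (f : Contract m) :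
    baseProfit f (levels hn f) ≤ 1 / 8 := by
  have h1 : (∑ i, effort (levels hn f) i * (1 - relPay f i)) / m ≤ 1 / 8 :=
    sum_div_le_of_le (by norm_num) fun i => slope_level_mul_le hn _
  have h2 : (0 : ℝ) ≤ f 0 := (f 0).2.1
  unfold baseProfit
  linarith

/-- Equality of the averages forces a tie in every coordinate, and in each coordinate the
tie-breaking in favour of the principal is strict. -/
lemma eq_levels_of_basePayoff_eq (hm : 0 < m) (hn : 0 < n) (f : Contract m)
    (a : Fin m → Fin (2 * n)) (h : basePayoff f a = basePayoff f (levels hn f))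
    (h' : baseProfit f (levels hn f) ≤ baseProfit f a) : a = levels hn f := by
  have hm' : (m : ℝ) ≠ 0 := by positivity
  have hle : ∀ i ∈ Finset.univ, levelPayoff n (a i) (relPay f i) ≤
      levelPayoff n (levels hn f i) (relPay f i) := fun i _ => levelPayoff_le_level hn (a i).2 _
  have heq := (Finset.sum_eq_sum_iff_of_le hle).1 ((div_left_inj' hm').1 h)
  have hs := fun i => slope_mul_le_of_levelPayoff_eq hn (a i).2 (heq i (Finset.mem_univ i))
  by_contra hne
  obtain ⟨i, hi⟩ := Function.ne_iff.1 hne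
  have hlt : ∑ i, effort a i * (1 - relPay f i) <
      ∑ i, effort (levels hn f) i * (1 - relPay f i) :=
    Finset.sum_lt_sum (fun i _ => (hs i).1) ⟨i, Finset.mem_univ i, (hs i).2 fun hh =>
      hi (Fin.ext hh)⟩
  have := div_lt_div_of_pos_right hlt (by positivity : (0 : ℝ) < m)
  unfold baseProfit at h'
  linarith

/-- A rebate can only attract the agent to `k`. A response that does not profit from it ties with
`levels hn f`, which is then optimal as well, so the principal's preference decides between the two.
-/
lemma eq_levels_of_isBestResponse (hm : 0 < m) (hn : 0 < n) (k : Fin m → Fin (2 * n)) (r : ℝ)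
    (hr : 0 ≤ r) (hk : r ≤ actionCost k) (f : Contract m) (a : Fin m → Fin (2 * n))
    (ha : (rebateInstance hn k r hr hk).IsBestResponse f a) (h : a ≠ k ∨ r = 0) :
    a = levels hn f := by
  classical
  have hopt : ∀ b : Fin m → Fin (2 * n), _ := ha.1
  have hfav : ∀ b : Fin m → Fin (2 * n), _ := ha.2
  simp only [principalUtility_rebateInstance] at hfav
  simp only [agentUtility_rebateInstance] at hopt
  have hz : (if a = k then r else 0) = 0 := by
    rcases h with h | h
    · rw [if_neg h]
    · simp [h]
  have h1 := hopt (levels hn f)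
  have h2 := basePayoff_le_levels hn f a
  have h3 : 0 ≤ if levels hn f = k then r else 0 := by split_ifs <;> simp [hr]
  rw [hz] at h1
  refine eq_levels_of_basePayoff_eq hm hn f a (by linarith) (hfav _ fun b => ?_)
  refine (ha.1 b).trans ?_
  simp only [agentUtility_rebateInstance, hz]
  linarith

/-- Where `k` is optimal for the agent, it is close to the optimum without rebate. -/
lemma sum_levelDist_le (hm : 0 < m) (hn : 0 < n) (k : Fin m → Fin (2 * n))
    (hk : 1 / (32 * n ^ 2) ≤ actionCost k) (f : Contract m)
    (h : (rebateInstance hn k (1 / (32 * n ^ 2)) (by positivity) hk).IsAgentOptimal f k) :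
    ∑ i, (levelDist (k i) (levels hn f i) : ℝ) * (levelDist (k i) (levels hn f i) - 1) ≤
      2 * m := by
  classical
  have hn' : (0 : ℝ) < n := by positivity
  have hm' : (0 : ℝ) < m := by positivity
  have h1 := h (levels hn f)
  simp only [agentUtility_rebateInstance, if_true] at h1
  have h3 : (0 : ℝ) ≤ if levels hn f = k then 1 / (32 * (n : ℝ) ^ 2) else 0 := by
    split_ifs <;> positivity
  have h4 : basePayoff f (levels hn f) - basePayoff f k ≤ 1 / (32 * n ^ 2) := by linarith
  have h5 : ∑ i, (levelDist (k i) (levels hn f i) : ℝ) *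
      (levelDist (k i) (levels hn f i) - 1) / (64 * n ^ 2) ≤
      ∑ i, (levelPayoff n (levels hn f i) (relPay f i) - levelPayoff n (k i) (relPay f i)) :=
    Finset.sum_le_sum fun i _ => levelDist_mul_le hn (k i).2 _
  rw [basePayoff, basePayoff, ← sub_div, ← Finset.sum_sub_distrib, div_le_iff₀ hm'] at h4
  have h6 := h5.trans h4
  rw [← Finset.sum_div, div_le_iff₀ (by positivity)] at h6
  calc _ ≤ _ := h6
    _ = 2 * m := by field_simp; norm_num

end OnlineContract

end

noncomputable section

namespace OnlineContract

variable {m n : ℕ}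

/-! ### The principal's utility -/

namespace ContractInstance

variable {I : ContractInstance m}

lemma continuous_agentUtility (a : I.Action) : Continuous fun f => I.agentUtility f a := by
  unfold agentUtility
  fun_prop

lemma continuous_principalUtility (a : I.Action) :
    Continuous fun f => I.principalUtility f a := by
  unfold principalUtility
  fun_prop

lemma isCompact_isAgentOptimal (a : I.Action) : IsCompact {f | I.IsAgentOptimal f a} := by
  refine IsClosed.isCompact ?_
  simp only [IsAgentOptimal, Set.ofPred_forall]
  exact isClosed_iInter fun b =>
    isClosed_le (continuous_agentUtility b) (continuous_agentUtility a)

namespace BestResponse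

variable (br : I.BestResponse)

lemma principalUtility_le_utility {f : Contract m} {a : I.Action} (h : I.IsAgentOptimal f a) :
    I.principalUtility f a ≤ br.utility f :=
  (br.isBestResponse f).2 a h

/-- The utility may jump, but favourable tie-breaking makes it the maximum of continuous functions
over the compact sets where each action is optimal, so the maximum is attained. -/
lemma exists_utility_le : ∃ g : Contract m, ∀ f, br.utility f ≤ br.utility g := by
  have hc : IsCompact (⋃ a, (fun f => I.principalUtility f a) '' {f | I.IsAgentOptimal f a}) :=
    isCompact_iUnion fun a =>
      (isCompact_isAgentOptimal a).image (continuous_principalUtility a)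
  have hmem : ∀ f, br.utility f ∈
      ⋃ a, (fun f => I.principalUtility f a) '' {f | I.IsAgentOptimal f a} := fun f =>
    Set.mem_iUnion.2 ⟨br.act f, f, (br.isBestResponse f).1, rfl⟩
  obtain ⟨y, hy, hmax⟩ := hc.exists_isGreatest ⟨_, hmem 0⟩
  obtain ⟨a, g, hg, rfl⟩ := Set.mem_iUnion.1 hy
  exact ⟨g, fun f => (hmax (hmem f)).trans (br.principalUtility_le_utility hg)⟩

lemma measurable_utility : Measurable br.utility := by
  classical
  have : br.utility = fun f => ∑ a, {f | br.act f = a}.indicator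
      (fun f => I.principalUtility f a) f := by
    ext f
    simp [utility, Set.indicator_apply]
  rw [this]
  exact Finset.measurable_sum _ fun a _ =>
    (I.measurable_principalUtility a).indicator (br.measurableSet_act a)

lemma abs_utility_le_one (f : Contract m) : |br.utility f| ≤ 1 := by
  unfold utility principalUtility
  calc _ ≤ ∑ o, |(I.prod (br.act f) o).toReal * (value m o - f o)| :=
        Finset.abs_sum_le_sum_abs _ _
    _ ≤ ∑ o, (I.prod (br.act f) o).toReal := Finset.sum_le_sum fun o _ => by
        rw [abs_mul, abs_of_nonneg ENNReal.toReal_nonneg]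
        refine mul_le_of_le_one_right ENNReal.toReal_nonneg (abs_le.2 ?_)
        have h0 := (f o).2.1
        have h1 := (f o).2.2
        unfold value
        split_ifs <;> constructor <;> linarith
    _ = 1 := sum_toReal_eq_one _

end BestResponse

end ContractInstance

/-! ### The hidden actions -/

/-- The hidden actions use only the upper half of the levels. -/
def hiddenAction (j : Fin m → Fin n) (i : Fin m) : Fin (2 * n) := ⟨n + j i, by omega⟩

lemma rebate_le_actionCost (hm : 0 < m) (hn : 0 < n) (j : Fin m → Fin n) :
    1 / (32 * (n : ℝ) ^ 2) ≤ actionCost (hiddenAction j) := by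
  have h1 : 1 / (8 * (n : ℝ)) ≤ actionCost (hiddenAction j) :=
    le_sum_div_of_le hm fun i => le_levelCost hn (Nat.le_add_right _ _) (hiddenAction j i).2.le
  have hn' : (1 : ℝ) ≤ n := by exact_mod_cast hn
  refine le_trans ?_ h1
  rw [div_le_div_iff₀ (by positivity) (by positivity)]
  nlinarith

/-- The instance in which the action given by `j` has a rebate. -/
def hiddenInstance (hm : 0 < m) (hn : 0 < n) (j : Fin m → Fin n) : ContractInstance m :=
  rebateInstance hn (hiddenAction j) (1 / (32 * (n : ℝ) ^ 2)) (by positivity)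
    (rebate_le_actionCost hm hn j)

/-- The contracts under which the hidden action is optimal for the agent. -/
def hiddenRegion (hm : 0 < m) (hn : 0 < n) (j : Fin m → Fin n) : Set (Contract m) :=
  {f | (hiddenInstance hm hn j).IsAgentOptimal f (hiddenAction j)}

lemma measurableSet_hiddenRegion (hm : 0 < m) (hn : 0 < n) (j : Fin m → Fin n) :
    MeasurableSet (hiddenRegion hm hn j) :=
  (hiddenInstance hm hn j).measurableSet_isAgentOptimal (hiddenAction j)

/-- The agent does not play the hidden action here, hence responds as if there were no rebate. -/
lemma utility_le_of_notMem (hm : 0 < m) (hn : 0 < n) (j : Fin m → Fin n)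
    (br : (hiddenInstance hm hn j).BestResponse) {f : Contract m}
    (hf : f ∉ hiddenRegion hm hn j) : br.utility f ≤ 1 / 8 := by
  have hne : br.act f ≠ hiddenAction j := fun h => hf (by
    have := (br.isBestResponse f).1
    rwa [h] at this)
  have := eq_levels_of_isBestResponse hm hn _ _ _ _ f (br.act f) (br.isBestResponse f) (.inl hne)
  calc br.utility f = baseProfit f (levels hn f) := by
        rw [← this]; exact principalUtility_rebateInstance _ _ _ _ _ _ _
    _ ≤ 1 / 8 := baseProfit_levels_le hn f

lemma exists_le_utility (hm : 0 < m) (hn : 0 < n) (j : Fin m → Fin n)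
    (br : (hiddenInstance hm hn j).BestResponse) :
    ∃ f, 1 / 8 + 1 / (32 * n) ≤ br.utility f := by
  classical
  have hn' : (1 : ℝ) ≤ n := by exact_mod_cast hn
  set k := hiddenAction j
  have hkn : ∀ i, n ≤ k i := fun i => Nat.le_add_right _ _
  have hs : 1 / (8 * (n : ℝ)) ≤ 1 / 2 := by
    rw [div_le_div_iff₀ (by positivity) (by positivity)]; linarith
  have hspos : 0 < 1 / (8 * (n : ℝ)) := by positivity
  -- Each payment falls short of its breakpoint by the amount that the rebate compensates. As the
  -- efforts of `k` are at least `1 / 4`, the principal saves at least `1 / (32 n)`.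
  let f : Contract m := Fin.cons 0 fun i => ⟨breakpoint n (k i) - 1 / (8 * n), by
    linarith [half_le_breakpoint hn (hkn i)], by
    linarith [breakpoint_lt_one hn (k i)]⟩
  have hx : ∀ i, relPay f i = breakpoint n (k i) - 1 / (8 * n) := fun i => by
    simp [relPay, f]
  have hopt : (hiddenInstance hm hn j).IsAgentOptimal f k := by
    intro (b : Fin m → Fin (2 * n))
    unfold hiddenInstance
    rw [agentUtility_rebateInstance, agentUtility_rebateInstance]
    by_cases hb : b = k
    · rw [hb]
    rw [if_neg hb, if_pos rfl]
    have h1 : ∑ i, levelPayoff n (b i) (relPay f i) ≤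
        ∑ i, (levelPayoff n (k i) (relPay f i) + 1 / (32 * n ^ 2)) :=
      Finset.sum_le_sum fun i _ => by
        rw [hx]
        exact levelPayoff_le_add hn (by have := hkn i; omega) (k i).2 (b i).2
    have h2 : basePayoff f b ≤ basePayoff f k + 1 / (32 * n ^ 2) := by
      unfold basePayoff
      rw [div_le_iff₀ (by positivity), add_mul, div_mul_cancel₀ _ (by positivity)]
      rw [Finset.sum_add_distrib] at h1
      simp only [Finset.sum_const, Finset.card_univ, Fintype.card_fin, nsmul_eq_mul] at h1
      linarith
    linarith
  refine ⟨f, le_trans ?_ (br.principalUtility_le_utility hopt)⟩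
  unfold hiddenInstance
  rw [principalUtility_rebateInstance]
  have hf0 : ((f 0 : unitInterval) : ℝ) = 0 := by simp [f]
  rw [baseProfit, hf0, sub_zero]
  refine le_sum_div_of_le hm fun i => ?_
  have h1 := slope_mul_breakpoint hn (hkn i)
  have h2 : 1 / 4 ≤ effort k i := by
    have : (n : ℝ) ≤ (k i : ℕ) := by exact_mod_cast hkn i
    unfold effort
    rw [div_le_div_iff₀ (by positivity) (by positivity)]; linarith
  rw [hx]
  calc (1 : ℝ) / 8 + 1 / (32 * n) = 1 / 8 + 1 / 4 * (1 / (8 * n)) := by field_simp; ring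
    _ ≤ effort k i * (1 - breakpoint n (k i)) + effort k i * (1 / (8 * n)) := by
        unfold effort at h2 ⊢
        rw [h1]
        gcongr
    _ = _ := by ring

lemma sum_levelDist_le_of_mem (hm : 0 < m) (hn : 0 < n) (j : Fin m → Fin n) {f : Contract m}
    (hf : f ∈ hiddenRegion hm hn j) :
    ∑ i, (levelDist (hiddenAction j i) (levels hn f i) : ℝ) *
      (levelDist (hiddenAction j i) (levels hn f i) - 1) ≤ 2 * m :=
  sum_levelDist_le hm hn _ (rebate_le_actionCost hm hn j) f hf

/-! ### Information revealed by a visit to the hidden region -/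

lemma abs_sub_eq_levelDist (a b : ℕ) : |(a : ℝ) - b| = levelDist a b := by
  unfold levelDist
  rcases le_total a b with h | h
  · rw [Nat.sub_eq_zero_of_le h, zero_add, Nat.cast_sub h, abs_sub_comm,
      abs_of_nonneg (sub_nonneg.2 (by exact_mod_cast h))]
  · rw [Nat.sub_eq_zero_of_le h, add_zero, Nat.cast_sub h,
      abs_of_nonneg (sub_nonneg.2 (by exact_mod_cast h))]

/-- Levels at distance `d` differ by `d / (4 n)` in effort, and `d² ≤ 2 d (d - 1) + 1`. The
denominators are harmless because the efforts of `k` lie between `1 / 4` and `1 / 2`: the null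
outcome has weight at least `1 / 2` and the others at least `1 / (4 m)`. The factor `m` cancels, so
the bound does not depend on the number of outcomes. -/
lemma sum_sq_div_outcomeWeight_le (hm : 0 < m) (hn : 0 < n) {a k : Fin m → Fin (2 * n)}
    (hk : ∀ i, n ≤ k i) (h : ∑ i, (levelDist (k i) (a i) : ℝ) *
      (levelDist (k i) (a i) - 1) ≤ 2 * m) :
    ∑ o, outcomeWeight (effort a) o ^ 2 / outcomeWeight (effort k) o ≤ 1 + 2 / n ^ 2 := by
  have hn' : (0 : ℝ) < n := by positivity
  have hm' : (0 : ℝ) < m := by positivity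
  have hk4 : ∀ i, 1 / 4 ≤ effort k i := fun i => by
    have : (n : ℝ) ≤ (k i : ℕ) := by exact_mod_cast hk i
    unfold effort
    rw [div_le_div_iff₀ (by positivity) (by positivity)]; linarith
  have hk0 : (1 : ℝ) / 2 ≤ 1 - (∑ i, effort k i) / m := by
    have := sum_div_le_of_le (m := m) (by norm_num : (0 : ℝ) ≤ 1 / 2) (effort_le_half k)
    linarith
  set S := ∑ i, (effort a i - effort k i) ^ 2 with hS
  have hSle : S ≤ 5 * m / (16 * n ^ 2) := by
    have h1 : ∀ i, (effort a i - effort k i) ^ 2 ≤ (2 * ((levelDist (k i) (a i) : ℝ) *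
        (levelDist (k i) (a i) - 1)) + 1) / (16 * n ^ 2) := fun i => by
      have : (effort a i - effort k i) ^ 2 = (levelDist (k i) (a i) : ℝ) ^ 2 / (16 * n ^ 2) := by
        rw [← abs_sub_eq_levelDist, sq_abs]
        unfold effort
        field_simp
        ring
      rw [this]
      gcongr
      nlinarith [sq_nonneg ((levelDist (k i) (a i) : ℝ) - 1)]
    refine (Finset.sum_le_sum fun i _ => h1 i).trans ?_
    rw [← Finset.sum_div, Finset.sum_add_distrib, ← Finset.mul_sum]
    simp only [Finset.sum_const, Finset.card_univ, Fintype.card_fin, nsmul_eq_mul, mul_one]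
    gcongr
    linarith
  have hrw : ∀ o, outcomeWeight (effort a) o ^ 2 / outcomeWeight (effort k) o =
      (outcomeWeight (effort a) o - outcomeWeight (effort k) o) ^ 2 / outcomeWeight (effort k) o
        + 2 * outcomeWeight (effort a) o - outcomeWeight (effort k) o := by
    intro o
    have hpos : 0 < outcomeWeight (effort k) o := by
      refine Fin.cases ?_ (fun i => ?_) o
      · simp only [outcomeWeight, Fin.cons_zero]; linarith
      · simp only [outcomeWeight, Fin.cons_succ]
        exact div_pos (by linarith [hk4 i]) hm'
    field_simp
    ring
  simp only [hrw, Finset.sum_sub_distrib, Finset.sum_add_distrib, ← Finset.mul_sum,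
    sum_outcomeWeight]
  suffices hmain : ∑ o, (outcomeWeight (effort a) o - outcomeWeight (effort k) o) ^ 2 /
      outcomeWeight (effort k) o ≤ 6 * S / m by
    have h2 : 6 * S / m ≤ 2 / n ^ 2 := by
      calc 6 * S / m ≤ 6 * (5 * m / (16 * n ^ 2)) / m := by gcongr
        _ = (15 / 8) / n ^ 2 := by field_simp; norm_num
        _ ≤ 2 / n ^ 2 := by gcongr; norm_num
    linarith
  rw [Fin.sum_univ_succ]
  simp only [outcomeWeight, Fin.cons_zero, Fin.cons_succ]
  have h0 : (1 - (∑ i, effort a i) / m - (1 - (∑ i, effort k i) / m)) ^ 2 /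
      (1 - (∑ i, effort k i) / m) ≤ 2 * S / m := by
    have hcs : (∑ i, (effort a i - effort k i)) ^ 2 ≤ m * S := by
      simpa using sq_sum_le_card_mul_sum_sq (s := Finset.univ)
        (f := fun i => effort a i - effort k i)
    rw [Finset.sum_sub_distrib] at hcs
    rw [div_le_iff₀ (by linarith)]
    have hS0 : 0 ≤ 2 * S / m :=
      div_nonneg (mul_nonneg zero_le_two (Finset.sum_nonneg fun i _ => sq_nonneg _)) hm'.le
    calc _ = ((∑ i, effort a i) - ∑ i, effort k i) ^ 2 / m ^ 2 := by field_simp; ring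
      _ ≤ m * S / m ^ 2 := by gcongr
      _ = 2 * S / m * (1 / 2) := by field_simp
      _ ≤ _ := mul_le_mul_of_nonneg_left hk0 hS0
  have h1 : ∀ i, (effort a i / m - effort k i / m) ^ 2 / (effort k i / m) ≤
      4 * (effort a i - effort k i) ^ 2 / m := fun i => by
    have hpos : 0 < effort k i := by linarith [hk4 i]
    calc _ = (effort a i - effort k i) ^ 2 / m * (1 / effort k i) := by field_simp
      _ ≤ (effort a i - effort k i) ^ 2 / m * 4 := by
          refine mul_le_mul_of_nonneg_left ?_ (by positivity)
          rw [div_le_iff₀ hpos]; linarith [hk4 i]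
      _ = _ := by ring
  have h2 := Finset.sum_le_sum fun i (_ : i ∈ Finset.univ) => h1 i
  rw [← Finset.sum_div, ← Finset.mul_sum] at h2
  calc _ ≤ 2 * S / m + 4 * S / m := add_le_add h0 h2
    _ = 6 * S / m := by ring

/-- The instance without rebate. -/
def baseInstance (m : ℕ) (hn : 0 < n) : ContractInstance m :=
  rebateInstance hn (fun _ => ⟨0, by omega⟩) 0 le_rfl (actionCost_nonneg _)

/-- Either the agent plays the hidden action, so that `f` is in the region and the chi-square bound
applies, or both instances induce the same response and the divergence is zero. -/
lemma sum_mul_le_log_hidden (hm : 0 < m) (hn : 0 < n) (j : Fin m → Fin n)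
    (br₀ : (baseInstance m hn).BestResponse) (br : (hiddenInstance hm hn j).BestResponse)
    (f : Contract m) (G : Outcome m → ℝ) :
    ∑ o, ((baseInstance m hn).prod (br₀.act f) o).toReal * G o ≤
      Real.log (∑ o, ((hiddenInstance hm hn j).prod (br.act f) o).toReal * Real.exp (G o)) +
        2 / (n : ℝ) ^ 2 * (hiddenRegion hm hn j).indicator 1 f := by
  have h0 : br₀.act f = levels hn f :=
    eq_levels_of_isBestResponse hm hn _ _ _ _ f (br₀.act f) (br₀.isBestResponse f) (.inr rfl)
  have hp : ∀ o, ((baseInstance m hn).prod (br₀.act f) o).toReal =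
      outcomeWeight (effort (levels hn f)) o := fun o => by
    rw [h0]; exact toReal_prod_rebateInstance _ _ _ _ _ _ _
  have hnn : ∀ (a : Fin m → Fin (2 * n)) o, 0 ≤ outcomeWeight (effort a) o := fun a =>
    outcomeWeight_nonneg (effort_nonneg a) fun i => by linarith [effort_le_half a i]
  by_cases hk : br.act f = hiddenAction j
  · have hf : f ∈ hiddenRegion hm hn j := by
      have := (br.isBestResponse f).1
      rwa [hk] at this
    have hq : ∀ o, ((hiddenInstance hm hn j).prod (br.act f) o).toReal =
        outcomeWeight (effort (hiddenAction j)) o := fun o => by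
      rw [hk]; exact toReal_prod_rebateInstance _ _ _ _ _ _ _
    simp only [hp, hq, Set.indicator_of_mem hf, Pi.one_apply, mul_one]
    refine sum_mul_le_log_sum_exp_add (hnn _) (hnn _) (fun o ho => ?_) (sum_outcomeWeight _)
      (sum_outcomeWeight _) (sum_sq_div_outcomeWeight_le hm hn
        (fun i => Nat.le_add_right _ _) (sum_levelDist_le_of_mem hm hn j hf)) G
    exfalso
    revert ho
    refine Fin.cases (fun ho => ?_) (fun i ho => ?_) o
    · have := sum_div_le_of_le (m := m) (by norm_num : (0 : ℝ) ≤ 1 / 2)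
        (effort_le_half (hiddenAction j))
      simp only [outcomeWeight, Fin.cons_zero] at ho
      linarith
    · have h2 : 0 < effort (hiddenAction j) i := by
        simp only [effort, hiddenAction]; positivity
      simp only [outcomeWeight, Fin.cons_succ] at ho
      have := div_pos h2 (by positivity : (0 : ℝ) < m)
      linarith
  · have h1 : br.act f = levels hn f :=
      eq_levels_of_isBestResponse hm hn _ _ _ _ f (br.act f) (br.isBestResponse f) (.inl hk)
    have hq : ∀ o, ((hiddenInstance hm hn j).prod (br.act f) o).toReal =
        outcomeWeight (effort (levels hn f)) o := fun o => by
      rw [h1]; exact toReal_prod_rebateInstance _ _ _ _ _ _ _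
    simp only [hp, hq]
    have := sum_mul_le_log_sum_exp_add (κ := 0) (hnn (levels hn f)) (hnn (levels hn f))
      (fun _ => id) (sum_outcomeWeight _) (sum_outcomeWeight _) (by
        simp only [sq, mul_self_div_self, sum_outcomeWeight]; norm_num) G
    have h2 : (0 : ℝ) ≤ 2 / n ^ 2 * (hiddenRegion hm hn j).indicator 1 f :=
      mul_nonneg (by positivity) (Set.indicator_nonneg (fun _ _ => zero_le_one) f)
    linarith

/-! ### The overlap of the regions -/

lemma sum_half_pow_levelDist_le (a N : ℕ) :
    ∑ l ∈ Finset.range N, (1 / 2 : ℝ) ^ levelDist l a ≤ 3 := by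
  have h1 : ∀ N ≤ a, ∑ l ∈ Finset.range N, (1 / 2 : ℝ) ^ levelDist l a ≤ (1 / 2) ^ (a - N) := by
    intro N
    induction N with
    | zero => intro _; simp
    | succ N ih =>
      intro h
      rw [Finset.sum_range_succ]
      have := ih (by omega)
      rw [show levelDist N a = a - N by unfold levelDist; omega]
      rw [show a - N = a - (N + 1) + 1 by omega, pow_succ] at this ⊢
      linarith
  have h2 : ∀ d, ∑ l ∈ Finset.range (a + d), (1 / 2 : ℝ) ^ levelDist l a ≤
      3 - 2 * (1 / 2) ^ d := by
    intro d
    induction d with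
    | zero =>
      have := h1 a le_rfl
      simp only [Nat.sub_self, pow_zero, add_zero] at this ⊢
      linarith
    | succ d ih =>
      rw [← add_assoc, Finset.sum_range_succ,
        show levelDist (a + d) a = d by unfold levelDist; omega, pow_succ]
      linarith
  rcases le_total N a with h | h
  · have := h1 N h
    have h3 : (1 / 2 : ℝ) ^ (a - N) ≤ 1 := pow_le_one₀ (by norm_num) (by norm_num)
    linarith
  · obtain ⟨d, rfl⟩ := Nat.exists_eq_add_of_le h
    have := h2 d
    have h3 : (0 : ℝ) < (1 / 2) ^ d := by positivity
    linarith

/-- Membership forces the total level distance to be at most `2 m`, so the indicator is at most `4 ^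
m * (1 / 2) ^ (total distance)`. This majorant factorizes over the coordinates, and each factor sums
to at most `4 * 3`. -/
lemma sum_indicator_hiddenRegion_le (hm : 0 < m) (hn : 0 < n) (f : Contract m) :
    ∑ j : Fin m → Fin n, (hiddenRegion hm hn j).indicator (1 : Contract m → ℝ) f ≤ 12 ^ m := by
  have hpt : ∀ j : Fin m → Fin n, (hiddenRegion hm hn j).indicator (1 : Contract m → ℝ) f ≤
      ∏ i, (4 * (1 / 2 : ℝ) ^ levelDist (n + j i) (levels hn f i)) := by
    intro j
    by_cases hf : f ∈ hiddenRegion hm hn j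
    · rw [Set.indicator_of_mem hf, Finset.prod_mul_distrib, Finset.prod_pow_eq_pow_sum]
      have h1 := sum_levelDist_le_of_mem hm hn j hf
      -- This is `0 ≤ (d - 1) (d - 2)`, which is true for integers only.
      have h2 : ∀ d : ℕ, (2 : ℝ) * d - 2 ≤ d * (d - 1) := fun d => by
        rcases d with _ | _ | d
        · norm_num
        · norm_num
        · push_cast
          nlinarith [(Nat.cast_nonneg d : (0 : ℝ) ≤ d)]
      have h3 := (Finset.sum_le_sum fun i (_ : i ∈ Finset.univ) =>
        h2 (levelDist (hiddenAction j i) (levels hn f i))).trans h1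
      rw [Finset.sum_sub_distrib, ← Finset.mul_sum] at h3
      simp only [Finset.sum_const, Finset.card_univ, Fintype.card_fin, nsmul_eq_mul] at h3
      have h4 : ∑ i, levelDist (n + j i) (levels hn f i) ≤ 2 * m := by
        have : ((∑ i, levelDist (n + j i) (levels hn f i) : ℕ) : ℝ) ≤ 2 * m := by
          push_cast
          change ∑ i, (levelDist (hiddenAction j i) (levels hn f i) : ℝ) ≤ _
          linarith
        exact_mod_cast this
      have h5 : (1 / 2 : ℝ) ^ (2 * m) ≤ (1 / 2) ^ ∑ i, levelDist (n + j i) (levels hn f i) :=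
        pow_le_pow_of_le_one (by norm_num) (by norm_num) h4
      calc (1 : ℝ) = 4 ^ m * (1 / 2) ^ (2 * m) := by
            rw [pow_mul, ← mul_pow]; norm_num
        _ ≤ _ := by
            simp only [Finset.prod_const, Finset.card_univ, Fintype.card_fin]
            gcongr
    · rw [Set.indicator_of_notMem hf]
      positivity
  refine (Finset.sum_le_sum fun j _ => hpt j).trans ?_
  rw [← Fintype.prod_sum (f := fun i (l : Fin n) =>
    4 * (1 / 2 : ℝ) ^ levelDist (n + l) (levels hn f i))]
  calc _ ≤ ∏ _i : Fin m, (12 : ℝ) := by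
        refine Finset.prod_le_prod (fun i _ => by positivity) fun i _ => ?_
        rw [← Finset.mul_sum,
          Fin.sum_univ_eq_sum_range fun l => (1 / 2 : ℝ) ^ levelDist (n + l) (levels hn f i)]
        have h1 := sum_half_pow_levelDist_le (levels hn f i) (n + n)
        rw [Finset.sum_range_add] at h1
        have h2 : 0 ≤ ∑ l ∈ Finset.range n, (1 / 2 : ℝ) ^ levelDist l (levels hn f i) := by
          positivity
        linarith
    _ = 12 ^ m := by simp

/-! ### The regret -/

/-- The number of rounds in which the contract lies in `R`. -/
def visits (R : Set (Contract m)) {T : ℕ} (h : History m T) : ℝ :=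
  ∑ t, R.indicator 1 (h t).1

lemma measurable_visits {R : Set (Contract m)} (hR : MeasurableSet R) (T : ℕ) :
    Measurable fun h : History m T => visits R h :=
  Finset.measurable_sum _ fun t _ => (measurable_one.indicator hR).comp
    (measurable_fst.comp (measurable_pi_apply t))

lemma visits_nonneg (R : Set (Contract m)) {T : ℕ} (h : History m T) : 0 ≤ visits R h :=
  Finset.sum_nonneg fun _ _ => Set.indicator_nonneg (fun _ _ => zero_le_one) _

lemma visits_le (R : Set (Contract m)) {T : ℕ} (h : History m T) : visits R h ≤ T := by
  calc visits R h ≤ ∑ _t : Fin T, (1 : ℝ) := Finset.sum_le_sum fun t _ => by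
        by_cases hf : (h t).1 ∈ R <;> simp [hf]
    _ = T := by simp

lemma integrable_visits {R : Set (Contract m)} (hR : MeasurableSet R) {T : ℕ}
    (μ : Measure (History m T)) [IsFiniteMeasure μ] : Integrable (fun h => visits R h) μ :=
  integrable_of_abs_le (measurable_visits hR T) T fun h => by
    rw [abs_of_nonneg (visits_nonneg R h)]; exact visits_le R h

lemma exists_integral_visits_le (hm : 0 < m) (hn : 0 < n) {T : ℕ} (μ : Measure (History m T))
    [IsProbabilityMeasure μ] :
    ∃ j : Fin m → Fin n, ∫ h, visits (hiddenRegion hm hn j) h ∂μ ≤ T * (12 / n) ^ m := by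
  have hsum : ∑ j : Fin m → Fin n, ∫ h, visits (hiddenRegion hm hn j) h ∂μ ≤
      ∑ _j : Fin m → Fin n, (T : ℝ) * (12 / n) ^ m := by
    rw [← integral_finsetSum _ fun j _ => integrable_visits (measurableSet_hiddenRegion hm hn j) μ]
    have h1 : ∀ h : History m T, ∑ j : Fin m → Fin n, visits (hiddenRegion hm hn j) h ≤
        T * 12 ^ m := fun h => by
      unfold visits
      rw [Finset.sum_comm]
      calc _ ≤ ∑ _t : Fin T, (12 : ℝ) ^ m :=
            Finset.sum_le_sum fun t _ => sum_indicator_hiddenRegion_le hm hn _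
        _ = T * 12 ^ m := by simp
    calc _ ≤ ∫ _, (T : ℝ) * 12 ^ m ∂μ := integral_mono
          (integrable_finsetSum _ fun j _ =>
            integrable_visits (measurableSet_hiddenRegion hm hn j) μ)
          (integrable_const _) h1
      _ = T * 12 ^ m := by simp
      _ = _ := by
          have : (n : ℝ) ≠ 0 := by positivity
          simp only [Finset.sum_const, Finset.card_univ, Fintype.card_pi, Fintype.card_fin,
            Finset.prod_const, nsmul_eq_mul, div_pow]
          push_cast
          field_simp
  have : Nonempty (Fin n) := ⟨⟨0, hn⟩⟩
  obtain ⟨j, _, hj⟩ := Finset.exists_le_of_sum_le Finset.univ_nonempty hsum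
  exact ⟨j, hj⟩

lemma le_expectedRegret (hm : 0 < m) (hn : 0 < n) (j : Fin m → Fin n)
    (br : (hiddenInstance hm hn j).BestResponse) (π : Policy m) (T : ℕ) {g : Contract m}
    (hg : ∀ f, br.utility f ≤ br.utility g) :
    1 / (32 * n) * (T - ∫ h, visits (hiddenRegion hm hn j) h ∂(historyLaw br π T)) ≤
      expectedRegret br π T g := by
  have hR := measurableSet_hiddenRegion hm hn j
  set μ := historyLaw br π T
  have hint : ∀ t : Fin T, Integrable (fun h : History m T =>
      (hiddenRegion hm hn j).indicator (1 : Contract m → ℝ) (h t).1) μ := fun t =>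
    integrable_of_abs_le ((measurable_one.indicator hR).comp
      (measurable_fst.comp (measurable_pi_apply t))) 1 fun h => by
        by_cases hf : (h t).1 ∈ hiddenRegion hm hn j <;> simp [hf]
  have hu : ∀ t : Fin T, Integrable (fun h : History m T => br.utility (h t).1) μ := fun t =>
    integrable_of_abs_le (br.measurable_utility.comp
      (measurable_fst.comp (measurable_pi_apply t))) 1 fun h => br.abs_utility_le_one _
  obtain ⟨f₁, hf₁⟩ := exists_le_utility hm hn j br
  have hgap : ∀ f, 1 / (32 * (n : ℝ)) *
      (1 - (hiddenRegion hm hn j).indicator (1 : Contract m → ℝ) f) ≤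
        br.utility g - br.utility f := fun f => by
    by_cases hf : f ∈ hiddenRegion hm hn j
    · simpa [hf] using hg f
    · have h1 := utility_le_of_notMem hm hn j br hf
      have h2 := hg f₁
      rw [Set.indicator_of_notMem hf, sub_zero, mul_one]
      linarith
  unfold expectedRegret visits
  rw [integral_finsetSum _ fun t _ => hint t]
  calc _ = ∑ t : Fin T, ∫ h, 1 / (32 * (n : ℝ)) *
        (1 - (hiddenRegion hm hn j).indicator (1 : Contract m → ℝ) (h t).1) ∂μ := by
        simp only [integral_const_mul]
        rw [← Finset.mul_sum]
        congr 1
        rw [Finset.sum_congr rfl fun t _ => integral_sub (integrable_const 1) (hint t)]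
        simp
    _ ≤ _ := Finset.sum_le_sum fun t _ =>
        integral_mono (((integrable_const 1).sub (hint t)).const_mul _)
          ((integrable_const _).sub (hu t)) fun h => hgap _

/-- The change of measure is applied to the fraction `G` of rounds outside the region. Its mean is
at least `3 / 4` without rebate, the divergence is at most `1 / 4`, and `exp G - 1 ≤ 2 G` on `[0,
1]`, so its mean with rebate is at least `1 / 4`. -/
lemma integral_visits_hidden_le (hm : 0 < m) (hn : 0 < n) (j : Fin m → Fin n)
    (br₀ : (baseInstance m hn).BestResponse) (br : (hiddenInstance hm hn j).BestResponse)
    (π : Policy m) {T : ℕ} (hT : 0 < T) {S : ℝ}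
    (hS : ∫ h, visits (hiddenRegion hm hn j) h ∂(historyLaw br₀ π T) ≤ S)
    (h1 : S ≤ T / 4) (h2 : 2 / n ^ 2 * S ≤ 1 / 4) :
    ∫ h, visits (hiddenRegion hm hn j) h ∂(historyLaw br π T) ≤ 3 / 4 * T := by
  have hR := measurableSet_hiddenRegion hm hn j
  set R := hiddenRegion hm hn j
  have hT' : (0 : ℝ) < T := by positivity
  let G : History m T → ℝ := fun h => 1 - visits R h / T
  have hGm : Measurable G := measurable_const.sub ((measurable_visits hR T).div_const _)
  have hG0 : ∀ h, 0 ≤ G h := fun h => by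
    have : visits R h / T ≤ 1 := (div_le_one hT').2 (visits_le R h)
    simp only [G]; linarith
  have hG1 : ∀ h, G h ≤ 1 := fun h => by
    have : 0 ≤ visits R h / T := div_nonneg (visits_nonneg R h) hT'.le
    simp only [G]; linarith
  have hGi : ∀ (μ : Measure (History m T)) [IsProbabilityMeasure μ], Integrable G μ :=
    fun μ _ => (integrable_const _).sub ((integrable_visits hR μ).div_const _)
  have hGe : ∀ (μ : Measure (History m T)) [IsProbabilityMeasure μ],
      ∫ h, G h ∂μ = 1 - (∫ h, visits R h ∂μ) / T := fun μ _ => by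
    simp only [G]
    rw [integral_sub (integrable_const _) ((integrable_visits hR μ).div_const _), integral_div]
    simp
  have hmain := integral_historyLaw_le br₀ br π hR
    (sum_mul_le_log_hidden hm hn j br₀ br) T hGm hG0 hG1
  have hexp : ∫ h, (Real.exp (G h) - 1) ∂(historyLaw br π T) ≤
      ∫ h, 2 * G h ∂(historyLaw br π T) := by
    refine integral_mono_of_nonneg (.of_forall fun h => ?_) ((hGi _).const_mul 2)
      (.of_forall fun h => ?_)
    · exact sub_nonneg.2 (Real.one_le_exp (hG0 h))
    · have h3 := Real.abs_exp_sub_one_sub_id_le (x := G h)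
        (by rw [abs_of_nonneg (hG0 h)]; exact hG1 h)
      have h4 := (abs_le.1 h3).2
      change Real.exp (G h) - 1 ≤ 2 * G h
      nlinarith [hG0 h, hG1 h]
  rw [integral_const_mul, hGe] at hexp
  rw [hGe] at hmain
  change _ ≤ _ + 2 / (n : ℝ) ^ 2 * ∫ h, visits R h ∂(historyLaw br₀ π T) at hmain
  have h5 : 2 / (n : ℝ) ^ 2 * ∫ h, visits R h ∂(historyLaw br₀ π T) ≤ 2 / n ^ 2 * S := by gcongr
  have h6 : (∫ h, visits R h ∂(historyLaw br₀ π T)) / T ≤ 1 / 4 := by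
    rw [div_le_iff₀ hT']; linarith
  have h7 : (∫ h, visits R h ∂(historyLaw br π T)) / T ≤ 3 / 4 := by linarith
  rwa [div_le_iff₀ hT'] at h7

/-- The resolution `n = ⌈24 τ⌉` with `τ = T ^ (1 / (m + 2))` balances the gap of the hidden actions
against the information that is needed to find them. -/
lemma exists_resolution (hm : 0 < m) {T : ℕ} (hT : 2 ^ (m + 2) < T) :
    ∃ n : ℕ, 0 < n ∧ (T : ℝ) * (12 / n) ^ m ≤ T / 4 ∧
      2 / (n : ℝ) ^ 2 * (T * (12 / n) ^ m) ≤ 1 / 4 ∧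
      1 / 3200 * (T : ℝ) ^ (1 - 1 / ((m : ℝ) + 2)) ≤ 1 / (32 * n) * (T / 4) := by
  have hT0 : 0 < T := lt_of_le_of_lt (Nat.zero_le _) hT
  have hT' : (0 : ℝ) < T := by exact_mod_cast hT0
  set τ : ℝ := (T : ℝ) ^ (1 / ((m : ℝ) + 2)) with hτ
  have hτpow : τ ^ (m + 2) = T := by
    rw [hτ, ← Real.rpow_natCast, ← Real.rpow_mul hT'.le]
    push_cast
    rw [one_div, inv_mul_cancel₀ (by positivity), Real.rpow_one]
  have hτ0 : 0 < τ := Real.rpow_pos_of_pos hT' _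
  have hτ2 : 2 ≤ τ := by
    by_contra! h
    have h1 : τ ^ (m + 2) < 2 ^ (m + 2) := pow_lt_pow_left₀ h hτ0.le (by omega)
    rw [hτpow] at h1
    have h2 : (2 : ℝ) ^ (m + 2) < T := by exact_mod_cast hT
    linarith
  have hlow : 24 * τ ≤ (⌈24 * τ⌉₊ : ℝ) := Nat.le_ceil _
  have hupp : (⌈24 * τ⌉₊ : ℝ) < 24 * τ + 1 := Nat.ceil_lt_add_one (by positivity)
  have hn0 : 0 < ⌈24 * τ⌉₊ := Nat.ceil_pos.2 (by positivity)
  generalize ⌈24 * τ⌉₊ = n at hlow hupp hn0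
  have hn' : (0 : ℝ) < n := by exact_mod_cast hn0
  -- The hypothesis on `T` enters here: it gives `2 ≤ τ`, hence `48 ≤ n`.
  have hx : 12 / (n : ℝ) ≤ 1 / 4 := by
    rw [div_le_div_iff₀ hn' (by norm_num)]; linarith
  have hx0 : 0 ≤ 12 / (n : ℝ) := by positivity
  refine ⟨n, hn0, ?_, ?_, ?_⟩
  · have : (12 / (n : ℝ)) ^ m ≤ 1 / 4 :=
      (pow_le_of_le_one hx0 (by linarith) (by omega)).trans hx
    nlinarith
  · have h1 : (12 / (n : ℝ) * τ) ^ m ≤ 1 := by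
      refine pow_le_one₀ (by positivity) ?_
      rw [div_mul_eq_mul_div, div_le_one hn']; linarith
    have h2 : 2 / (n : ℝ) ^ 2 * τ ^ 2 ≤ 1 / 4 := by
      rw [div_mul_eq_mul_div, div_le_div_iff₀ (by positivity) (by norm_num)]
      nlinarith [mul_self_le_mul_self (by positivity) hlow, sq_nonneg τ]
    -- Of the `m + 2` factors `τ` of `T`, `m` are absorbed by the small share of the region and two
    -- by the divergence of a single visit.
    calc 2 / (n : ℝ) ^ 2 * (T * (12 / n) ^ m)
        = (2 / (n : ℝ) ^ 2 * τ ^ 2) * (12 / (n : ℝ) * τ) ^ m := by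
          rw [← hτpow, mul_pow, pow_add]; ring
      _ ≤ 1 / 4 * 1 := mul_le_mul h2 h1 (by positivity) (by norm_num)
      _ = 1 / 4 := mul_one _
  -- Here `n ≤ 25 τ`, and `3200 = 32 * 4 * 25`.
  · rw [Real.rpow_sub hT', Real.rpow_one, ← hτ, div_mul_div_comm, one_mul, div_mul_div_comm,
      div_le_div_iff₀ (by positivity) (by positivity)]
    nlinarith

lemma exists_instance_le_expectedRegret {m : ℕ} (hm : 0 < m) {T : ℕ} (hT : 2 ^ (m + 2) < T)
    (π : Policy m) : ∃ I : ContractInstance m, ∀ br : I.BestResponse, ∃ g : Contract m,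
      (∀ f, br.utility f ≤ br.utility g) ∧
        1 / 3200 * (T : ℝ) ^ (1 - 1 / ((m : ℝ) + 2)) ≤ expectedRegret br π T g := by
  obtain ⟨n, hn, h1, h2, h3⟩ := exists_resolution hm hT
  obtain ⟨br₀⟩ : Nonempty (baseInstance m hn).BestResponse := inferInstance
  -- The index is chosen from the behaviour of `π` without rebate, so the instance does not depend
  -- on the tie-breaking `br` considered afterwards.
  obtain ⟨j, hj⟩ := exists_integral_visits_le hm hn (historyLaw br₀ π T)
  refine ⟨hiddenInstance hm hn j, fun br => ?_⟩
  obtain ⟨g, hg⟩ := br.exists_utility_le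
  refine ⟨g, hg, h3.trans (le_trans ?_ (le_expectedRegret hm hn j br π T hg))⟩
  have h4 := integral_visits_hidden_le hm hn j br₀ br π (Nat.zero_lt_of_lt hT) hj h1 h2
  gcongr
  linarith

end OnlineContract

end

theorem theorem3p4 :
    ∃ C : ℝ, 0 < C ∧
      ∀ m : ℕ, 1 ≤ m → ∀ T : ℕ, 2 ^ (m + 2) < T →
        ∀ π : OnlineContract.Policy m,
          ∃ I : OnlineContract.ContractInstance m, ∀ br : I.BestResponse,
            ∃ fstar : OnlineContract.Contract m,
              (∀ f : OnlineContract.Contract m, br.utility f ≤ br.utility fstar) ∧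
              C * (T : ℝ) ^ (1 - 1 / ((m : ℝ) + 2)) ≤
                OnlineContract.expectedRegret br π T fstar :=
  ⟨1 / 3200, by norm_num, fun _ hm _ hT π =>
    OnlineContract.exists_instance_le_expectedRegret hm hT π⟩
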